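/- Let $(D,\mu)$ be a measure space with $D\neq\emptyset$, and let $H$ be a reproducing kernel Hilbert space of complex-valued functions on $D$ with reproducing kernel $k_H$. Assume that $H$ is injectively embedded into $L_2=L_2(D,\mu)$, i.e., $H\subset L_2$, the embedding $I\colon H\to L_2$ (mapping a function to its $\mu$-equivalence class) is continuous, and two functions in $H$ that are equal $\mu$-a.e. are equal pointwise. Assume also that the kernel has finite trace, $$\int_D k_H(x,x)\,d\mu(x)<\infty .$$ Then there is an orthonormal basis $(e_k)_{0\le k<\dim H}$ of $H$ (with $\dim H\in\mathbb N_0\cup\{\infty\}$) and a decreasing sequence of positive numbers $(\sigma_k)_{0\le k<\dim H}$ such that $I^*I e_k=\sigma_k^2e_k$ for all $k$. For any such choice, put $\sigma_k:=0$ for $k\ge\dim H$, let $b_k:=\sigma_k^{-1}e_k$ for $k<\dim H$ (the singular functions), and let $V_m:=\operatorname{span}\{b_k : k<m,\ k<\dim H\}$. Then $\sum_k\sigma_k^2<\infty$, and the following holds. For points $x_1,\dots,x_n\in D$ (repetitions allowed) and weights $w=(w_1,\dots,w_n)\in(0,\infty)^n$, let $A^w_{\mathcal P_n}(f)$ denote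 the minimizer of $\sum_{i=1}^n w_i|f(x_i)-g(x_i)|^2$ over $g\in V_m$. (a) For all integers $m\ge1$ and $n\ge m$, with $r:=(n+1)/m$, there exist points $x_1,\dots,x_n\in D$ and positive weights $w_1,\dots,w_n$ such that the minimizer $A^w_{\mathcal P_n}(f)$ is unique for every $f\colon D\to\mathbb C$ and, for every $f\in H$, $$\|f-A^w_{\mathcal P_n}(f)\|_2\le\frac{\sqrt{2r}}{\sqrt r-1}\left(\sigma_m+\sqrt{\frac1{rm}\sum_{k\ge m}\sigma_k^2}\right)\inf_{g\in V_m}\|f-g\|_H .$$ (b) If, in addition, $\mu$ is a probability measure and the constant function $1$ belongs to $V_m$, then there exist points $x_1,\dots,x_n\in D$ and positive weights with $\sum_{i=1}^n w_i\le 9$ such that $$\|g\|_2\le\frac{\sqrt r}{\sqrt r-1}\sqrt{\sum_{i=1}^n w_i|g(x_i)|^2}\qquad\text{for all } g\in V_m,$$ the minimizer $A^w_{\mathcal P_n}(f)$ is unique for every $f\colon D\to\mathbb C$, and the error bound in (a) holds for every $f\in H$ with an extra factor $4$ on the right-hand side. (c) Let $B_H=\{f\in H:\|f\|_H\le1\}$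 and let $$g_n^{\mathrm{lin}}(B_H,L_2):=\inf_{\substack{x_1,\dots,x_n\in D\\ \varphi_1,\dots,\varphi_n\in L_2}}\ \sup_{f\in B_H}\Big\|f-\sum_{i=1}^n f(x_i)\varphi_i\Big\|_2 .$$ Then, for all integers $m\ge1$, $$g_{2m-1}^{\mathrm{lin}}(B_H,L_2)\le5\left(\sigma_m+\sqrt{\frac1m\sum_{k\ge m}\sigma_k^2}\right)\quad\text{and}\quad g_{m}^{\mathrm{lin}}(B_H,L_2)\le5m\left(\sigma_m+\sqrt{\frac1m\sum_{k\ge m}\sigma_k^2}\right).$$ -/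

import Mathlib

open MeasureTheory
open scoped ENNReal

noncomputable section

/-- `I` is the embedding of the reproducing kernel Hilbert space `H` of functions on `D` into
`L₂(D, μ)`: every `f ∈ H` is square-integrable, `I f` is the `μ`-equivalence class of `f`, `I` is
continuous, and it is injective (two functions in `H` that agree `μ`-a.e. agree pointwise). -/
structure IsL2Embedding {D : Type*} [MeasurableSpace D] (μ : Measure D)
    {H : Type*} [NormedAddCommGroup H] [InnerProductSpace ℂ H] [RKHS ℂ H D ℂ]
    (I : H →L[ℂ] Lp ℂ 2 μ) : Prop where
  coe_ae_eq : ∀ f : H, (I f : D → ℂ) =ᵐ[μ] (f : D → ℂ)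
  injective : Function.Injective I

/-- The reproducing kernel has finite trace: `∫ k(x, x) dμ(x) < ∞` (note `k(x, x) ≥ 0`). -/
def HasFiniteTrace {D : Type*} [MeasurableSpace D] (μ : Measure D)
    (H : Type*) [NormedAddCommGroup H] [InnerProductSpace ℂ H] [CompleteSpace H]
    [RKHS ℂ H D ℂ] : Prop :=
  ∫⁻ x, ‖RKHS.kernel H x x (1 : ℂ)‖ₑ ∂μ < ∞

/-- `σ` are the singular values of `I`, and `e` is a corresponding orthonormal basis of eigenvectors
of `I* I`. The sequence `σ` is decreasing; the basis consists of the `e k` with `σ k > 0`, and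
satisfies `I* I (e k) = (σ k)² e k`. As `I` is injective in the application, the indices with
`σ k > 0` are exactly the `k < dim H`; if `H` is finite-dimensional, the sequences are extended
by `0` for `k ≥ dim H`. -/
structure IsSingularSystem {H : Type*} [NormedAddCommGroup H] [InnerProductSpace ℂ H]
    [CompleteSpace H] {Y : Type*} [NormedAddCommGroup Y] [InnerProductSpace ℂ Y] [CompleteSpace Y]
    (I : H →L[ℂ] Y) (σ : ℕ → ℝ) (e : ℕ → H) : Prop where
  antitone : Antitone σ
  nonneg : ∀ k, 0 ≤ σ k
  orthonormal : Orthonormal ℂ (fun k : {k : ℕ // 0 < σ k} => e k)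
  complete : (Submodule.span ℂ (Set.range e)).topologicalClosure = ⊤
  eq_zero : ∀ k, σ k = 0 → e k = 0
  eigen : ∀ k, ContinuousLinearMap.adjoint I (I (e k)) = ((σ k : ℂ) ^ 2) • e k

/-- The singular functions `b k = (σ k)⁻¹ e k`, normalized in `L₂`
(and `b k = 0` for `k ≥ dim H`). -/
def singularFunction {H : Type*} [NormedAddCommGroup H] [InnerProductSpace ℂ H]
    (σ : ℕ → ℝ) (e : ℕ → H) (k : ℕ) : H :=
  ((σ k : ℂ)⁻¹) • e k

/-- `V_m`, the span of the singular functions `b k` with `k < m`. -/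
def singularSpace {H : Type*} [NormedAddCommGroup H] [InnerProductSpace ℂ H]
    (σ : ℕ → ℝ) (e : ℕ → H) (m : ℕ) : Submodule ℂ H :=
  Submodule.span ℂ (singularFunction σ e '' Set.Iio m)

/-- The square of the discrete seminorm of a function: `∑ i, w i |f (x i)|²`. -/
def discreteNormSq {D : Type*} {n : ℕ} (x : Fin n → D) (w : Fin n → ℝ) (f : D → ℂ) : ℝ :=
  ∑ i, w i * ‖f (x i)‖ ^ 2

/-- `A` is the weighted least squares algorithm for the points `x`, the weights `w` and the space
`V`: for each `f : D → ℂ`, the discrete seminorm of `f - g` has a unique minimizer `g` in `V`,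
and this minimizer is `A f`. -/
def IsLeastSquaresAlgorithm {D : Type*}
    {H : Type*} [NormedAddCommGroup H] [InnerProductSpace ℂ H] [RKHS ℂ H D ℂ]
    (V : Submodule ℂ H) {n : ℕ} (x : Fin n → D) (w : Fin n → ℝ) (A : (D → ℂ) → H) : Prop :=
  ∀ (f : D → ℂ) (g : H),
    (g ∈ V ∧ IsMinOn (fun h : H => discreteNormSq x w (f - (h : D → ℂ))) (V : Set H) g) ↔ g = A f

/-- The unit ball of `H`, as a class of functions on `D`. -/
def unitBall (D : Type*) (H : Type*) [NormedAddCommGroup H] [InnerProductSpace ℂ H]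
    [RKHS ℂ H D ℂ] : Set (D → ℂ) :=
  {f | ∃ h : H, ‖h‖ ≤ 1 ∧ f = (h : D → ℂ)}

/-- The `n`-th linear sampling number of a class `F` of functions in `L₂(D, μ)`: the infimum over
points `x 1, …, x n` in `D` and functions `φ 1, …, φ n` in `L₂` of the worst case error
`sup_{f ∈ F} ‖f - ∑ i, f (x i) φ i‖₂`. -/
def linSamplingNumber {D : Type*} [MeasurableSpace D] (n : ℕ) (F : Set (D → ℂ))
    (μ : Measure D) : ℝ≥0∞ :=
  ⨅ (x : Fin n → D) (φ : Fin n → D → ℂ) (_ : ∀ i, MemLp (φ i) 2 μ),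
    ⨆ f ∈ F, eLpNorm (f - ∑ i, f (x i) • φ i) 2 μ

end

/-! Two families of vectors are discretized at once. On `V_m`, the coefficient vectors v(x) of point
evaluation form a tight frame, ∫ |⟨v(x), y⟩|² dμ = ‖y‖², of trace at most m. On the orthogonal
complement of `V_m` in H, the projected representers h(x) = Q k_x have a frame operator of norm at
most σ_m² and trace at most S = ∑_{k ≥ m} σ_k². It suffices to find n points and weights s_i with ∑
s_i |⟨v(x_i), y⟩|² ≥ (√(n+1) - √m)² ‖y‖² and ∑ s_i |⟨h(x_i), z⟩|² ≤ (√S + √(n+1) σ_m)² ‖z‖².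

The points come one at a time from the two-barrier method (`exists_barrier_step`,
`exists_weighted_points`). The barriers advance by fixed amounts, and averaging over x yields a
point and a weight for which neither potential exceeds its bound. The potentials are traces of
resolvents against the frame operators rather than plain traces, so the complement may be
infinite-dimensional. A constant κ added to the average caps the weights, at the price of a factor
in the upper estimate; this gives (b).

For the error (`exists_leastSquares`), let z be f minus its H-orthogonal projection onto `V_m`. Then
f - A f = z - A z with z and A z orthogonal in L₂. The norm of z is controlled by σ_m, that of A z
by the two discrete inequalities. Part (c) is the case r = 2 or r = (m+1)/m.

The singular system exists because the kernel trace bounds the Hilbert–Schmidt norm of I, so I is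
compact and the spectral theorem applies to I* I. -/

open scoped InnerProductSpace
open RCLike

/-! ### Coercive operators, their inverses and rank one updates. -/

section CoercivePair

variable {𝕜 E : Type*} [RCLike 𝕜] [NormedAddCommGroup E] [InnerProductSpace 𝕜 E]

/-- `T` is a symmetric coercive operator and `M` is its inverse. -/
structure CoercivePair (T M : E →L[𝕜] E) : Prop where
  symm : ∀ x y, ⟪T x, y⟫_𝕜 = ⟪x, T y⟫_𝕜
  coercive : ∃ c > 0, ∀ x, c * ‖x‖ ^ 2 ≤ re ⟪T x, x⟫_𝕜
  apply_inv : ∀ x, T (M x) = x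
  inv_apply : ∀ x, M (T x) = x

theorem exists_coercivePair [CompleteSpace E] {T : E →L[𝕜] E}
    (hs : ∀ x y, ⟪T x, y⟫_𝕜 = ⟪x, T y⟫_𝕜) {c : ℝ} (hc : 0 < c)
    (h : ∀ x, c * ‖x‖ ^ 2 ≤ re ⟪T x, x⟫_𝕜) : ∃ M : E →L[𝕜] E, CoercivePair T M := by
  have hu : IsUnit T := by
    refine ContinuousLinearMap.isUnit_of_forall_le_norm_inner_map T (c := ⟨c, hc.le⟩) hc fun x => ?_
    calc ‖x‖ ^ 2 * c = c * ‖x‖ ^ 2 := mul_comm _ _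
      _ ≤ re ⟪T x, x⟫_𝕜 := h x
      _ ≤ _ := RCLike.re_le_norm _
  obtain ⟨u, rfl⟩ := hu
  refine ⟨(u⁻¹ : (E →L[𝕜] E)ˣ), hs, ⟨c, hc, h⟩, fun x => ?_, fun x => ?_⟩
  · exact congrArg (fun L : E →L[𝕜] E => L x) u.mul_inv
  · exact congrArg (fun L : E →L[𝕜] E => L x) u.inv_mul

/-- The Cauchy–Schwarz inequality for the form of a positive symmetric operator. -/
theorem norm_inner_map_sq_le {M : E →L[𝕜] E} (hs : ∀ x y, ⟪M x, y⟫_𝕜 = ⟪x, M y⟫_𝕜)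
    (hp : ∀ x, 0 ≤ re ⟪x, M x⟫_𝕜) (x y : E) :
    ‖⟪x, M y⟫_𝕜‖ ^ 2 ≤ re ⟪x, M x⟫_𝕜 * re ⟪y, M y⟫_𝕜 := by
  let C : PreInnerProductSpace.Core 𝕜 E :=
    { inner := fun x y => ⟪x, M y⟫_𝕜
      conj_inner_symm := fun x y => by rw [inner_conj_symm, hs]
      re_inner_nonneg := hp
      add_left := fun x y z => inner_add_left _ _ _
      smul_left := fun x y r => inner_smul_left _ _ _ }
  have h := @InnerProductSpace.Core.inner_mul_inner_self_le 𝕜 E _ _ _ C x y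
  change ‖⟪x, M y⟫_𝕜‖ * ‖⟪y, M x⟫_𝕜‖ ≤ re ⟪x, M x⟫_𝕜 * re ⟪y, M y⟫_𝕜 at h
  rwa [← hs y x, ← inner_conj_symm (M y) x, RCLike.norm_conj, ← sq] at h

namespace CoercivePair

variable {T M T' M' : E →L[𝕜] E}

theorem inv_symm (h : CoercivePair T M) (x y : E) : ⟪M x, y⟫_𝕜 = ⟪x, M y⟫_𝕜 := by
  rw [← h.apply_inv y, ← h.symm, h.apply_inv, h.inv_apply]

theorem inner_inv_self (h : CoercivePair T M) (x : E) :
    ⟪x, M x⟫_𝕜 = (re ⟪x, M x⟫_𝕜 : 𝕜) := by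
  have : (starRingEnd 𝕜) ⟪x, M x⟫_𝕜 = ⟪x, M x⟫_𝕜 := by rw [inner_conj_symm, h.inv_symm]
  exact (RCLike.conj_eq_iff_re.1 this).symm

theorem self_nonneg (h : CoercivePair T M) (x : E) : 0 ≤ re ⟪x, T x⟫_𝕜 := by
  obtain ⟨c, hc, hT⟩ := h.coercive
  rw [← h.symm]
  exact (by positivity : 0 ≤ c * ‖x‖ ^ 2).trans (hT x)

theorem inv_nonneg (h : CoercivePair T M) (x : E) : 0 ≤ re ⟪x, M x⟫_𝕜 := by
  have := h.self_nonneg (M x)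
  rwa [h.apply_inv, h.inv_symm] at this

/-- The resolvent identity. -/
theorem resolvent (h : CoercivePair T M) (h' : CoercivePair T' M') {d : ℝ}
    (hd : T' = T + (d : 𝕜) • ContinuousLinearMap.id 𝕜 E) (x : E) :
    M x = M' x + (d : 𝕜) • M (M' x) := by
  have h1 : T' (M' x) = T (M' x) + (d : 𝕜) • M' x := by rw [hd]; simp
  rw [h'.apply_inv] at h1
  conv_lhs => rw [h1]
  rw [map_add, h.inv_apply, map_smul]

/-- The Sherman–Morrison update of the inverse under a rank one perturbation. -/
theorem add_rankOne (h : CoercivePair T M) (v : E) {τ : ℝ}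
    (hτ : 0 < τ ∨ τ < -re ⟪v, M v⟫_𝕜) :
    CoercivePair (T + ((τ⁻¹ : ℝ) : 𝕜) • InnerProductSpace.rankOne 𝕜 v v)
      (M - (((τ + re ⟪v, M v⟫_𝕜)⁻¹ : ℝ) : 𝕜) • InnerProductSpace.rankOne 𝕜 (M v) (M v)) := by
  set a := re ⟪v, M v⟫_𝕜 with ha
  have ha0 : 0 ≤ a := h.inv_nonneg v
  have hτ0 : τ ≠ 0 := by rcases hτ with h | h <;> intro h0 <;> linarith
  have hτa : τ + a ≠ 0 := by rcases hτ with h | h <;> intro h0 <;> linarith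
  have hvv : ⟪v, M v⟫_𝕜 = (a : 𝕜) := h.inner_inv_self v
  have hτ0' : (τ : 𝕜) ≠ 0 := by exact_mod_cast hτ0
  have hτa' : (τ : 𝕜) + a ≠ 0 := by exact_mod_cast hτa
  obtain ⟨c, hc, hT⟩ := h.coercive
  refine ⟨fun x y => ?_, ?_, fun x => ?_, fun x => ?_⟩
  · simp [inner_add_left, inner_add_right, inner_smul_left, inner_smul_right, h.symm]
    left; ring
  · have key : ∀ x, re ⟪(T + ((τ⁻¹ : ℝ) : 𝕜) • InnerProductSpace.rankOne 𝕜 v v) x, x⟫_𝕜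
        = re ⟪T x, x⟫_𝕜 + τ⁻¹ * ‖⟪v, x⟫_𝕜‖ ^ 2 := by
      intro x
      have : ⟪x, v⟫_𝕜 * ⟪v, x⟫_𝕜 = ((‖⟪v, x⟫_𝕜‖ ^ 2 : ℝ) : 𝕜) := by
        rw [← inner_conj_symm, RCLike.conj_mul]; push_cast; rfl
      simp only [add_apply, smul_apply,
        InnerProductSpace.rankOne_apply, inner_add_left, inner_smul_left, RCLike.conj_ofReal,
        inner_conj_symm, map_add, this, ← RCLike.ofReal_mul, RCLike.ofReal_re]
    -- For τ > 0 the added term only helps. For τ < -a the fraction 1 + a/τ of the coercivity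
    -- survives, by Cauchy–Schwarz for the form of T and v = T (M v).
    rcases hτ with hp | hn
    · refine ⟨c, hc, fun x => ?_⟩
      rw [key]
      have : 0 ≤ τ⁻¹ * ‖⟪v, x⟫_𝕜‖ ^ 2 := by positivity
      linarith [hT x]
    · have hτn : τ < 0 := by linarith
      have hpos : 0 < 1 + τ⁻¹ * a := by
        have : 1 + τ⁻¹ * a = (τ + a) / τ := by field_simp
        rw [this]; exact div_pos_of_neg_of_neg (by linarith) hτn
      refine ⟨(1 + τ⁻¹ * a) * c, by positivity, fun x => ?_⟩
      rw [key]
      have hcs := norm_inner_map_sq_le h.symm h.self_nonneg (M v) x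
      rw [← h.symm, h.apply_inv, h.inv_symm, ← ha, ← h.symm] at hcs
      have h1 : τ⁻¹ * (a * re ⟪T x, x⟫_𝕜) ≤ τ⁻¹ * ‖⟪v, x⟫_𝕜‖ ^ 2 :=
        mul_le_mul_of_nonpos_left hcs (inv_nonpos.2 hτn.le)
      have h2 := mul_le_mul_of_nonneg_left (hT x) hpos.le
      nlinarith [h1, h2]
  · simp only [add_apply, sub_apply,
      smul_apply, InnerProductSpace.rankOne_apply, map_sub, map_smul,
      h.apply_inv, h.inv_symm, hvv]
    push_cast
    match_scalars
    · ring
    · field_simp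
      ring
  · simp only [add_apply, sub_apply,
      smul_apply, InnerProductSpace.rankOne_apply, map_add, map_smul,
      h.inv_apply, h.inv_symm, hvv]
    push_cast
    match_scalars
    · ring
    · field_simp
      ring

end CoercivePair

end CoercivePair

/-! ### Barrier potentials and one step of the two-barrier method. -/

section Barrier

variable {𝕜 D E F : Type*} [RCLike 𝕜] [MeasurableSpace D] {μ : Measure D}
  [NormedAddCommGroup E] [InnerProductSpace 𝕜 E] [NormedAddCommGroup F] [InnerProductSpace 𝕜 F]

theorem integrable_re_inner {f g : D → E} (hf : MemLp f 2 μ) (hg : MemLp g 2 μ) :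
    Integrable (fun x => re ⟪f x, g x⟫_𝕜) μ := by
  refine (hf.norm.integrable_mul hg.norm).mono'
    (hf.1.inner hg.1).re (Filter.Eventually.of_forall fun x => ?_)
  exact (RCLike.norm_re_le_norm _).trans (norm_inner_le_norm _ _)

theorem integrable_norm_sq {f : D → E} (hf : MemLp f 2 μ) : Integrable (fun x => ‖f x‖ ^ 2) μ :=
  (memLp_two_iff_integrable_sq_norm hf.1).1 hf

theorem integrable_norm_inner_sq {f : D → E} (hf : MemLp f 2 μ) (y : E) :
    Integrable (fun x => ‖⟪f x, y⟫_𝕜‖ ^ 2) μ :=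
  integrable_norm_sq (hf.inner_const y)

variable (μ) in
/-- The trace of `M` against the frame operator of `h`, which serves as a barrier potential. -/
noncomputable def barrierPotential (h : D → E) (M : E →L[𝕜] E) : ℝ :=
  ∫ x, re ⟪h x, M (h x)⟫_𝕜 ∂μ

theorem memLp_map {h : D → E} (hh : MemLp h 2 μ) (M : E →L[𝕜] E) :
    MemLp (fun x => M (h x)) 2 μ := M.comp_memLp' hh

/-- Together with `CoercivePair.add_rankOne`, this computes how the potential changes when a point
is added. -/
theorem barrierPotential_sub_rankOne {h : D → E} (hh : MemLp h 2 μ) (M : E →L[𝕜] E) (c : ℝ)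
    (w : E) :
    barrierPotential μ h (M - (c : 𝕜) • InnerProductSpace.rankOne 𝕜 w w) =
      barrierPotential μ h M - c * ∫ x, ‖⟪h x, w⟫_𝕜‖ ^ 2 ∂μ := by
  unfold barrierPotential
  rw [← integral_const_mul, ← integral_sub (integrable_re_inner hh (memLp_map hh M))
    ((integrable_norm_inner_sq hh w).const_mul c)]
  congr 1 with x
  have : ⟪w, h x⟫_𝕜 * ⟪h x, w⟫_𝕜 = ((‖⟪h x, w⟫_𝕜‖ ^ 2 : ℝ) : 𝕜) := by
    rw [← inner_conj_symm, RCLike.conj_mul]; push_cast; rfl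
  simp only [sub_apply, smul_apply, InnerProductSpace.rankOne_apply, inner_sub_right,
    inner_smul_right, map_sub, this, ← RCLike.ofReal_mul, RCLike.ofReal_re]

theorem barrierPotential_nonneg {h : D → E} {T M : E →L[𝕜] E} (hT : CoercivePair T M) :
    0 ≤ barrierPotential μ h M :=
  integral_nonneg fun _ => hT.inv_nonneg _

/-- The largest eigenvalue of M is at most its trace: integrate Cauchy–Schwarz for the form of M
over the tight frame. Hence a bound ε on the potential keeps T above 1/ε. -/
theorem norm_sq_le_barrierPotential_mul {v : D → E} (hv : MemLp v 2 μ)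
    (hiso : ∀ y, ∫ x, ‖⟪v x, y⟫_𝕜‖ ^ 2 ∂μ = ‖y‖ ^ 2) {T M : E →L[𝕜] E} (hT : CoercivePair T M)
    (z : E) : ‖z‖ ^ 2 ≤ barrierPotential μ v M * re ⟪T z, z⟫_𝕜 := by
  have h := integral_mono (integrable_norm_inner_sq (𝕜 := 𝕜) hv (M (T z)))
    ((integrable_re_inner hv (memLp_map hv M)).mul_const (re ⟪T z, M (T z)⟫_𝕜))
    (fun x => norm_inner_map_sq_le hT.inv_symm hT.inv_nonneg (v x) (T z))
  rwa [hiso, integral_mul_const, hT.inv_apply] at h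

/-- The average gain of the upper barrier. -/
theorem mul_integral_le_barrierPotential_sub {h : D → F} (hh : MemLp h 2 μ)
    {S N S' N' : F →L[𝕜] F} (hS : CoercivePair S N) (hS' : CoercivePair S' N') {δ : ℝ}
    (hδ : 0 ≤ δ) (hd : S' = S + (δ : 𝕜) • ContinuousLinearMap.id 𝕜 F) :
    δ * ∫ x, ‖N' (h x)‖ ^ 2 ∂μ ≤ barrierPotential μ h N - barrierPotential μ h N' := by
  unfold barrierPotential
  rw [← integral_const_mul, ← integral_sub (integrable_re_inner hh (memLp_map hh N))
    (integrable_re_inner hh (memLp_map hh N'))]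
  refine integral_mono ((integrable_norm_sq (memLp_map hh N')).const_mul δ)
    ((integrable_re_inner hh (memLp_map hh N)).sub (integrable_re_inner hh (memLp_map hh N')))
    fun x => ?_
  -- The resolvent identity is used twice; the second-order term is nonnegative and is dropped.
  have h1 : ⟪h x, N (h x)⟫_𝕜 = ⟪h x, N' (h x)⟫_𝕜 + δ * ⟪N' (h x), N' (h x)⟫_𝕜
      + δ * (δ * ⟪N' (h x), N (N' (h x))⟫_𝕜) := by
    conv_lhs => rw [hS.resolvent hS' hd, inner_add_right, inner_smul_right, ← hS.inv_symm,
      hS.resolvent hS' hd, inner_add_left, inner_smul_left, RCLike.conj_ofReal, hS.inv_symm]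
    ring
  have h2 := hS.inv_nonneg (N' (h x))
  simp only [h1, map_add, RCLike.re_ofReal_mul, inner_self_eq_norm_sq]
  have : 0 ≤ δ * (δ * re ⟪N' (h x), N (N' (h x))⟫_𝕜) := by positivity
  linarith

/-- The average gain of the lower barrier. -/
theorem barrierPotential_sub_mul_le_integral [Nontrivial E] {v : D → E} (hv : MemLp v 2 μ)
    (hiso : ∀ y, ∫ x, ‖⟪v x, y⟫_𝕜‖ ^ 2 ∂μ = ‖y‖ ^ 2)
    {T M T' M' : E →L[𝕜] E} (hT : CoercivePair T M) (hT' : CoercivePair T' M') {δ : ℝ}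
    (hδ : 0 < δ) (hd : T' = T + ((-δ : ℝ) : 𝕜) • ContinuousLinearMap.id 𝕜 E)
    (hpot : δ * barrierPotential μ v M ≤ 1) :
    0 < barrierPotential μ v M' - barrierPotential μ v M ∧
    (barrierPotential μ v M' - barrierPotential μ v M) *
      (1 / δ - barrierPotential μ v M + barrierPotential μ v M') ≤ ∫ x, ‖M' (v x)‖ ^ 2 ∂μ := by
  have hM := memLp_map hv M
  have hM' := memLp_map hv M'
  have hMM' := memLp_map hM' M
  have hres : ∀ y, M' y = M y + (δ : 𝕜) • M (M' y) := fun y => by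
    rw [hT.resolvent hT' hd y]; simp
  -- As v is a tight frame, `p` and `q` are the traces of M M' and M' M M'. The potential grows by
  -- δp, and ∫ ‖M' v‖² = p + δq, so the claim reduces to δp² ≤ q.
  set p := ∫ x, re ⟪M (v x), M' (v x)⟫_𝕜 ∂μ with hp
  set q := ∫ x, re ⟪M' (v x), M (M' (v x))⟫_𝕜 ∂μ with hq
  have hq0 : 0 ≤ q := integral_nonneg fun x => hT.inv_nonneg _
  have hΔ : barrierPotential μ v M' - barrierPotential μ v M = δ * p := by
    unfold barrierPotential
    rw [← integral_sub (integrable_re_inner hv hM') (integrable_re_inner hv hM), hp,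
      ← integral_const_mul]
    congr 1 with x
    have : re ⟪v x, M' (v x)⟫_𝕜 = re ⟪v x, M (v x)⟫_𝕜 + δ * re ⟪M (v x), M' (v x)⟫_𝕜 := by
      conv_lhs => rw [hres, inner_add_right, inner_smul_right, ← hT.inv_symm (v x) (M' (v x)),
        map_add, RCLike.re_ofReal_mul]
    rw [this]
    ring
  have hnorm : ∫ x, ‖M' (v x)‖ ^ 2 ∂μ = p + δ * q := by
    rw [hp, hq, ← integral_const_mul, ← integral_add (integrable_re_inner hM hM')
      ((integrable_re_inner hM' hMM').const_mul δ)]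
    congr 1 with x
    rw [← inner_self_eq_norm_sq (𝕜 := 𝕜)]
    conv_lhs => rw [← inner_conj_symm]
    nth_rewrite 2 [hres]
    rw [inner_add_right, inner_smul_right, map_add, map_add, RCLike.conj_re, map_mul,
      RCLike.conj_ofReal, RCLike.re_ofReal_mul, RCLike.conj_re, ← inner_conj_symm, RCLike.conj_re]
  -- Cauchy–Schwarz for the integrated form of M, via the discriminant of its value at v - t M' v.
  have hcs : p ^ 2 ≤ barrierPotential μ v M * q := by
    have hquad : ∀ t : ℝ, 0 ≤ q * (t * t) + (-2 * p) * t + barrierPotential μ v M := by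
      intro t
      have h0 : 0 ≤ ∫ x, (re ⟪M' (v x), M (M' (v x))⟫_𝕜 * (t * t)
          + (-2 * t) * re ⟪M (v x), M' (v x)⟫_𝕜 + re ⟪v x, M (v x)⟫_𝕜) ∂μ := by
        refine integral_nonneg fun x => ?_
        have := hT.inv_nonneg (v x - (t : 𝕜) • M' (v x))
        simp only [map_sub, map_smul, inner_sub_left, inner_sub_right, inner_smul_left,
          inner_smul_right, RCLike.conj_ofReal, RCLike.re_ofReal_mul] at this
        have e1 : re ⟪v x, M (M' (v x))⟫_𝕜 = re ⟪M (v x), M' (v x)⟫_𝕜 := by rw [hT.inv_symm]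
        have e2 : re ⟪M' (v x), M (v x)⟫_𝕜 = re ⟪M (v x), M' (v x)⟫_𝕜 := by
          rw [← inner_conj_symm, RCLike.conj_re]
        rw [e1, e2] at this
        change 0 ≤ _
        nlinarith [this]
      have i1 : Integrable (fun x => re ⟪M' (v x), M (M' (v x))⟫_𝕜 * (t * t)
          + (-2 * t) * re ⟪M (v x), M' (v x)⟫_𝕜) μ :=
        ((integrable_re_inner hM' hMM').mul_const _).add
          ((integrable_re_inner hM hM').const_mul _)
      rw [integral_add i1 (integrable_re_inner hv hM),
        integral_add ((integrable_re_inner hM' hMM').mul_const _)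
        ((integrable_re_inner hM hM').const_mul _), integral_mul_const, integral_const_mul] at h0
      change 0 ≤ q * (t * t) + -2 * t * p + barrierPotential μ v M at h0
      linarith
    have := discrim_le_zero hquad
    rw [discrim] at this
    nlinarith
  -- If p vanished, M v and hence v would vanish almost everywhere, contradicting tightness on a
  -- nontrivial space.
  have hp0 : 0 < p := by
    have hle : ∫ x, ‖M (v x)‖ ^ 2 ∂μ ≤ p := by
      refine integral_mono (integrable_norm_sq hM) (integrable_re_inner hM hM') fun x => ?_
      have e : M' (v x) = M (v x) + (δ : 𝕜) • M' (M (v x)) := by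
        have h2 : T = T' + (δ : 𝕜) • ContinuousLinearMap.id 𝕜 E := by
          rw [hd]; simp
        exact hT'.resolvent hT h2 _
      change ‖M (v x)‖ ^ 2 ≤ re ⟪M (v x), M' (v x)⟫_𝕜
      rw [e, inner_add_right, inner_smul_right, map_add, RCLike.re_ofReal_mul,
        inner_self_eq_norm_sq]
      have := hT'.inv_nonneg (M (v x))
      nlinarith
    refine lt_of_lt_of_le (lt_of_le_of_ne (integral_nonneg fun x => by positivity) fun h0 => ?_) hle
    have hae := (integral_eq_zero_iff_of_nonneg (fun x => by positivity)
      (integrable_norm_sq hM)).1 h0.symm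
    obtain ⟨y, hy⟩ := exists_ne (0 : E)
    have hy' := hiso y
    rw [integral_eq_zero_of_ae] at hy'
    · exact hy (norm_eq_zero.1 (pow_eq_zero_iff two_ne_zero |>.1 hy'.symm))
    · filter_upwards [hae] with x hx
      have hMv : M (v x) = 0 := by
        simpa using hx
      have hvx : v x = 0 := by rw [← hT.apply_inv (v x), hMv, map_zero]
      simp [hvx]
  rw [hnorm]
  have h3 : 1 / δ - barrierPotential μ v M + barrierPotential μ v M' = 1 / δ + δ * p := by
    rw [← hΔ]; ring
  rw [h3, hΔ]
  refine ⟨by positivity, ?_⟩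
  have h4 : δ * p * (1 / δ + δ * p) = p + δ * (δ * p ^ 2) := by field_simp
  rw [h4]
  have h5 : δ * p ^ 2 ≤ q := by
    calc δ * p ^ 2 ≤ δ * (barrierPotential μ v M * q) := by gcongr
      _ = (δ * barrierPotential μ v M) * q := by ring
      _ ≤ 1 * q := by gcongr
      _ = q := one_mul q
  nlinarith

/-- One step of the two-barrier method of Batson, Spielman and Srivastava. -/
theorem exists_barrier_step [CompleteSpace E] [CompleteSpace F] [Nontrivial E]
    {v : D → E} (hv : MemLp v 2 μ) (hiso : ∀ y, ∫ x, ‖⟪v x, y⟫_𝕜‖ ^ 2 ∂μ = ‖y‖ ^ 2)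
    {h : D → F} (hh : MemLp h 2 μ) {σ : ℝ}
    (hbd : ∀ y, ∫ x, ‖⟪h x, y⟫_𝕜‖ ^ 2 ∂μ ≤ σ ^ 2 * ‖y‖ ^ 2)
    {κ : ℝ} (hκ : 0 ≤ κ) (hκi : Integrable (fun _ : D => κ) μ)
    {εL εU δL δU : ℝ} (hδL : 0 < δL) (hδU : 0 < δU) (hεL : δL * εL < 1)
    (hbudget : σ ^ 2 / δU + εU + ∫ _, κ ∂μ < 1 / δL - εL)
    {T M : E →L[𝕜] E} (hT : CoercivePair T M) (hTpot : barrierPotential μ v M ≤ εL)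
    {S N : F →L[𝕜] F} (hS : CoercivePair S N) (hSpot : barrierPotential μ h N ≤ εU) :
    ∃ (x : D) (s : ℝ), 0 < s ∧ κ * s ≤ 1 ∧
      (∃ M' : E →L[𝕜] E, CoercivePair (T + ((-δL : ℝ) : 𝕜) • ContinuousLinearMap.id 𝕜 E +
        (s : 𝕜) • InnerProductSpace.rankOne 𝕜 (v x) (v x)) M' ∧ barrierPotential μ v M' ≤ εL) ∧
      (∃ N' : F →L[𝕜] F, CoercivePair (S + (δU : 𝕜) • ContinuousLinearMap.id 𝕜 F +
        ((-s : ℝ) : 𝕜) • InnerProductSpace.rankOne 𝕜 (h x) (h x)) N' ∧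
        barrierPotential μ h N' ≤ εU) := by
  have hεL0 : 0 < εL := by
    obtain ⟨y, hy⟩ := exists_ne (0 : E)
    have h1 := norm_sq_le_barrierPotential_mul hv hiso hT y
    have h2 : 0 < ‖y‖ ^ 2 := by positivity
    have h3 := (barrierPotential_nonneg (h := v) (μ := μ) hT)
    rcases h3.eq_or_lt with h0 | h0
    · rw [← h0] at h1; linarith
    · linarith
  obtain ⟨M₁, hT₁⟩ : ∃ M₁, CoercivePair (T + ((-δL : ℝ) : 𝕜) • ContinuousLinearMap.id 𝕜 E) M₁ := by
    -- The potential bound gives T ≥ 1/εL, so the shift by δL < 1/εL preserves coercivity.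
    refine exists_coercivePair (c := 1 / εL - δL) (fun x y => ?_) ?_ fun z => ?_
    · simp [inner_add_left, inner_add_right, inner_smul_left, inner_smul_right, hT.symm]
    · rw [sub_pos, lt_div_iff₀ hεL0]; exact hεL
    · have h1 := norm_sq_le_barrierPotential_mul hv hiso hT z
      have hTz : 0 ≤ re ⟪T z, z⟫_𝕜 := by rw [hT.symm]; exact hT.self_nonneg z
      have h2 : ‖z‖ ^ 2 / εL ≤ re ⟪T z, z⟫_𝕜 := by
        rw [div_le_iff₀ hεL0]
        nlinarith [mul_le_mul_of_nonneg_right hTpot hTz]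
      simp only [add_apply, smul_apply, ContinuousLinearMap.id_apply, inner_add_left,
        inner_smul_left, RCLike.conj_ofReal, map_add, RCLike.re_ofReal_mul, inner_self_eq_norm_sq]
      rw [sub_mul, one_div_mul_eq_div]
      linarith
  obtain ⟨N₁, hS₁⟩ : ∃ N₁, CoercivePair (S + (δU : 𝕜) • ContinuousLinearMap.id 𝕜 F) N₁ := by
    refine exists_coercivePair (c := δU) (fun x y => ?_) hδU fun z => ?_
    · simp [inner_add_left, inner_add_right, inner_smul_left, inner_smul_right, hS.symm]
    · have hSz : 0 ≤ re ⟪S z, z⟫_𝕜 := by rw [hS.symm]; exact hS.self_nonneg z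
      simp only [add_apply, smul_apply, ContinuousLinearMap.id_apply, inner_add_left,
        inner_smul_left, RCLike.conj_ofReal, map_add, RCLike.re_ofReal_mul, inner_self_eq_norm_sq]
      linarith
  obtain ⟨hΔL, hL⟩ := barrierPotential_sub_mul_le_integral hv hiso hT hT₁ hδL rfl
    ((mul_le_mul_of_nonneg_left hTpot hδL.le).trans hεL.le)
  have hU := mul_integral_le_barrierPotential_sub hh hS hS₁ hδU.le rfl
  set ΔL := barrierPotential μ v M₁ - barrierPotential μ v M with hΔLdef
  set ΔU := barrierPotential μ h N - barrierPotential μ h N₁ with hΔUdef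
  have hN1 : 0 ≤ ∫ x, ‖N₁ (h x)‖ ^ 2 ∂μ := integral_nonneg fun x => by positivity
  have hΔU : 0 ≤ ΔU := (mul_nonneg hδU.le hN1).trans hU
  -- When ΔU = 0, the quotient by ΔU below is 0 by convention and carries no information; this
  -- almost sure statement replaces it.
  have hae : ∀ᵐ x ∂μ, ΔU = 0 → N₁ (h x) = 0 := by
    by_cases h0 : ΔU = 0
    · have : ∫ x, ‖N₁ (h x)‖ ^ 2 ∂μ = 0 := by
        rw [h0] at hU
        exact le_antisymm (nonpos_of_mul_nonpos_right hU hδU) hN1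
      filter_upwards [(integral_eq_zero_iff_of_nonneg (fun x => by positivity)
        (integrable_norm_sq (memLp_map hh N₁))).1 this] with x hx _
      simpa using hx
    · exact Filter.Eventually.of_forall fun x hx => absurd hx h0
  have iL : Integrable (fun x => ‖M₁ (v x)‖ ^ 2 / ΔL - re ⟪v x, M₁ (v x)⟫_𝕜) μ :=
    ((integrable_norm_sq (memLp_map hv M₁)).div_const _).sub
      (integrable_re_inner hv (memLp_map hv M₁))
  have iU : Integrable (fun x => σ ^ 2 * ‖N₁ (h x)‖ ^ 2 / ΔU + re ⟪h x, N₁ (h x)⟫_𝕜) μ :=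
    (((integrable_norm_sq (memLp_map hh N₁)).const_mul _).div_const _).add
      (integrable_re_inner hh (memLp_map hh N₁))
  -- The right side integrates to at least 1/δL - εL, the left side to at most σ²/δU + εU + ∫ κ,
  -- which is strictly smaller by the budget.
  obtain ⟨x, hx0, hx⟩ : ∃ x, (ΔU = 0 → N₁ (h x) = 0) ∧
      σ ^ 2 * ‖N₁ (h x)‖ ^ 2 / ΔU + re ⟪h x, N₁ (h x)⟫_𝕜 + κ <
        ‖M₁ (v x)‖ ^ 2 / ΔL - re ⟪v x, M₁ (v x)⟫_𝕜 := by
    by_contra! hcon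
    have iUκ : Integrable (fun x => σ ^ 2 * ‖N₁ (h x)‖ ^ 2 / ΔU + re ⟪h x, N₁ (h x)⟫_𝕜 + κ) μ :=
      iU.add hκi
    have hle := integral_mono_ae iL iUκ (hae.mono fun x hx => hcon x hx)
    have hLint : 1 / δL - εL ≤ ∫ x, (‖M₁ (v x)‖ ^ 2 / ΔL - re ⟪v x, M₁ (v x)⟫_𝕜) ∂μ := by
      rw [integral_sub ((integrable_norm_sq (memLp_map hv M₁)).div_const _)
        (integrable_re_inner hv (memLp_map hv M₁)), integral_div]
      change _ ≤ _ - barrierPotential μ v M₁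
      have : 1 / δL - barrierPotential μ v M + barrierPotential μ v M₁ ≤
          (∫ x, ‖M₁ (v x)‖ ^ 2 ∂μ) / ΔL := by
        rw [le_div_iff₀ hΔL]; linarith
      linarith
    have hUint : ∫ x, (σ ^ 2 * ‖N₁ (h x)‖ ^ 2 / ΔU + re ⟪h x, N₁ (h x)⟫_𝕜 + κ) ∂μ ≤ σ ^ 2 / δU + εU + ∫ _, κ ∂μ := by
      rw [integral_add iU hκi, integral_add
        (((integrable_norm_sq (memLp_map hh N₁)).const_mul _).div_const _)
        (integrable_re_inner hh (memLp_map hh N₁)), integral_div, integral_const_mul]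
      change _ + barrierPotential μ h N₁ + _ ≤ _
      have h1 : σ ^ 2 * (∫ x, ‖N₁ (h x)‖ ^ 2 ∂μ) / ΔU ≤ σ ^ 2 / δU := by
        rcases hΔU.eq_or_lt with h0 | h0
        · rw [← h0, div_zero]; positivity
        · rw [div_le_div_iff₀ h0 hδU]
          nlinarith [mul_le_mul_of_nonneg_left hU (sq_nonneg σ)]
      linarith
    linarith
  set a := re ⟪h x, N₁ (h x)⟫_𝕜 with ha
  set b := re ⟪v x, M₁ (v x)⟫_𝕜 with hb
  -- The weight is 1/t, with t the largest value allowed by the lower barrier: the update then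
  -- undoes the increase ΔL exactly. As t exceeds the left side, the upper potential does not grow
  -- and κ ≤ t.
  set t := ‖M₁ (v x)‖ ^ 2 / ΔL - b with ht
  have ha0 : 0 ≤ a := hS₁.inv_nonneg _
  have hb0 : 0 ≤ b := hT₁.inv_nonneg _
  have hfrac : 0 ≤ σ ^ 2 * ‖N₁ (h x)‖ ^ 2 / ΔU := by positivity
  have hta : a < t := by linarith
  have ht0 : 0 < t := by linarith
  refine ⟨x, t⁻¹, by positivity, ?_, ?_, ?_⟩
  · rw [← div_eq_mul_inv, div_le_one ht0]; linarith
  · refine ⟨_, hT₁.add_rankOne (v x) (Or.inl ht0), ?_⟩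
    rw [barrierPotential_sub_rankOne hv, hiso]
    have : (t + b)⁻¹ * ‖M₁ (v x)‖ ^ 2 = ΔL := by
      have h1 : t + b = ‖M₁ (v x)‖ ^ 2 / ΔL := by rw [ht]; ring
      have h2 : 0 < t + b := by linarith
      rw [inv_mul_eq_iff_eq_mul₀ h2.ne', h1, div_mul_cancel₀ _ hΔL.ne']
    rw [this]
    linarith
  · have hτ : -t < -a := by linarith
    refine ⟨_, by simpa only [inv_neg] using hS₁.add_rankOne (h x) (Or.inr hτ), ?_⟩
    rw [barrierPotential_sub_rankOne hh]
    have h1 : 0 < t - a := by linarith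
    have h2 : (-t + a)⁻¹ = -(t - a)⁻¹ := by rw [← inv_neg]; congr 1; ring
    have h3 : σ ^ 2 * ‖N₁ (h x)‖ ^ 2 ≤ (t - a) * ΔU := by
      rcases hΔU.eq_or_lt with h0 | h0
      · rw [hx0 h0.symm]; simp [← h0]
      · rw [← div_le_iff₀ h0]; linarith
    have h4 : (t - a)⁻¹ * ∫ y, ‖⟪h y, N₁ (h x)⟫_𝕜‖ ^ 2 ∂μ ≤ ΔU := by
      rw [inv_mul_le_iff₀ h1]; exact (hbd _).trans h3
    rw [← ha, h2]
    linarith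

end Barrier

/-! ### Iterating the barrier step and choosing the parameters. -/

section Sampling

variable {𝕜 D E F : Type*} [RCLike 𝕜] [MeasurableSpace D] {μ : Measure D}
  [NormedAddCommGroup E] [InnerProductSpace 𝕜 E] [NormedAddCommGroup F] [InnerProductSpace 𝕜 F]

theorem coercivePair_smul_id {p : ℝ} (hp : 0 < p) :
    CoercivePair ((p : 𝕜) • ContinuousLinearMap.id 𝕜 E)
      (((p⁻¹ : ℝ) : 𝕜) • ContinuousLinearMap.id 𝕜 E) := by
  have hp' : (p : 𝕜) ≠ 0 := by exact_mod_cast hp.ne'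
  refine ⟨fun x y => ?_, ⟨p, hp, fun x => ?_⟩, fun x => ?_, fun x => ?_⟩
  · simp [inner_smul_left, inner_smul_right]
  · simp only [smul_apply, ContinuousLinearMap.id_apply, inner_smul_left, RCLike.conj_ofReal,
      RCLike.re_ofReal_mul, inner_self_eq_norm_sq, le_refl]
  · simp [smul_smul, hp']
  · simp [smul_smul, hp']

theorem barrierPotential_smul_id (h : D → E) (p : ℝ) :
    barrierPotential μ h ((p : 𝕜) • ContinuousLinearMap.id 𝕜 E) = p * ∫ x, ‖h x‖ ^ 2 ∂μ := by
  unfold barrierPotential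
  rw [← integral_const_mul]
  congr 1 with x
  simp only [smul_apply, ContinuousLinearMap.id_apply, inner_smul_right, RCLike.re_ofReal_mul,
    inner_self_eq_norm_sq]

theorem re_inner_smul_id_add_sum_rankOne {n : ℕ} (p : ℝ) (s : Fin n → ℝ) (w : Fin n → E) (z : E) :
    re ⟪((p : 𝕜) • ContinuousLinearMap.id 𝕜 E +
      ∑ i, (s i : 𝕜) • InnerProductSpace.rankOne 𝕜 (w i) (w i)) z, z⟫_𝕜 =
      p * ‖z‖ ^ 2 + ∑ i, s i * ‖⟪w i, z⟫_𝕜‖ ^ 2 := by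
  have h : ∀ i, ⟪z, w i⟫_𝕜 * ⟪w i, z⟫_𝕜 = ((‖⟪w i, z⟫_𝕜‖ ^ 2 : ℝ) : 𝕜) := by
    intro i
    rw [← inner_conj_symm, RCLike.conj_mul]; push_cast; rfl
  simp only [add_apply, smul_apply, ContinuousLinearMap.id_apply, sum_apply,
    InnerProductSpace.rankOne_apply, inner_add_left, inner_smul_left, sum_inner, map_add, map_sum,
    RCLike.conj_ofReal, RCLike.re_ofReal_mul, inner_self_eq_norm_sq, inner_conj_symm, h,
    RCLike.ofReal_re]

/-- In the induction, the first operator is the sampled frame operator of v minus the lower barrier,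
the second the upper barrier minus that of h. At the end the lower potential yields the extra gain
1/εL, whereas above only positivity is used. -/
theorem exists_points_of_barriers [CompleteSpace E] [CompleteSpace F] [Nontrivial E]
    {v : D → E} (hv : MemLp v 2 μ) (hiso : ∀ y, ∫ x, ‖⟪v x, y⟫_𝕜‖ ^ 2 ∂μ = ‖y‖ ^ 2)
    {h : D → F} (hh : MemLp h 2 μ) {σ : ℝ}
    (hbd : ∀ y, ∫ x, ‖⟪h x, y⟫_𝕜‖ ^ 2 ∂μ ≤ σ ^ 2 * ‖y‖ ^ 2)
    {κ : ℝ} (hκ : 0 ≤ κ) (hκi : Integrable (fun _ : D => κ) μ)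
    {εL εU δL δU p u : ℝ} (hδL : 0 < δL) (hδU : 0 < δU) (hεL : 0 < εL) (hδε : δL * εL < 1)
    (hp : 0 < p) (hu : 0 < u) (hvp : ∫ x, ‖v x‖ ^ 2 ∂μ ≤ εL * p)
    (hhu : ∫ x, ‖h x‖ ^ 2 ∂μ ≤ εU * u)
    (hbudget : σ ^ 2 / δU + εU + ∫ _, κ ∂μ < 1 / δL - εL) (n : ℕ) :
    ∃ (x : Fin n → D) (s : Fin n → ℝ), (∀ i, 0 < s i) ∧ (∀ i, κ * s i ≤ 1) ∧
      (∀ y, (1 / εL - p + n * δL) * ‖y‖ ^ 2 ≤ ∑ i, s i * ‖⟪v (x i), y⟫_𝕜‖ ^ 2) ∧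
      (∀ y, ∑ i, s i * ‖⟪h (x i), y⟫_𝕜‖ ^ 2 ≤ (u + n * δU) * ‖y‖ ^ 2) := by
  obtain ⟨x, s, hs, hκs, ⟨M, hM, hMp⟩, N, hN, hNp⟩ : ∃ (x : Fin n → D) (s : Fin n → ℝ),
      (∀ i, 0 < s i) ∧ (∀ i, κ * s i ≤ 1) ∧
      (∃ M, CoercivePair (((p - n * δL : ℝ) : 𝕜) • ContinuousLinearMap.id 𝕜 E +
        ∑ i, (s i : 𝕜) • InnerProductSpace.rankOne 𝕜 (v (x i)) (v (x i))) M ∧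
        barrierPotential μ v M ≤ εL) ∧
      (∃ N, CoercivePair (((u + n * δU : ℝ) : 𝕜) • ContinuousLinearMap.id 𝕜 F +
        ∑ i, ((-s i : ℝ) : 𝕜) • InnerProductSpace.rankOne 𝕜 (h (x i)) (h (x i))) N ∧
        barrierPotential μ h N ≤ εU) := by
    induction n with
    | zero =>
      refine ⟨Fin.elim0, Fin.elim0, fun i => i.elim0, fun i => i.elim0,
        ⟨_, by simpa using coercivePair_smul_id hp, ?_⟩,
        ⟨_, by simpa using coercivePair_smul_id hu, ?_⟩⟩
      · rw [barrierPotential_smul_id, inv_mul_le_iff₀ hp, mul_comm]; exact hvp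
      · rw [barrierPotential_smul_id, inv_mul_le_iff₀ hu, mul_comm]; exact hhu
    | succ k ih =>
      obtain ⟨x, s, hs, hκs, ⟨M, hM, hMp⟩, N, hN, hNp⟩ := ih
      obtain ⟨x₀, s₀, hs₀, hκs₀, ⟨M', hM', hMp'⟩, N', hN', hNp'⟩ :=
        exists_barrier_step hv hiso hh hbd hκ hκi hδL hδU hδε hbudget hM hMp hN hNp
      refine ⟨Fin.cons x₀ x, Fin.cons s₀ s, fun i => ?_, fun i => ?_,
        ⟨M', ?_, hMp'⟩, ⟨N', ?_, hNp'⟩⟩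
      · refine Fin.cases ?_ ?_ i <;> simp [hs₀, hs]
      · refine Fin.cases ?_ ?_ i <;> simp [hκs₀, hκs]
      · convert hM' using 1
        simp only [Fin.sum_univ_succ, Fin.cons_zero, Fin.cons_succ]
        push_cast
        module
      · convert hN' using 1
        simp only [Fin.sum_univ_succ, Fin.cons_zero, Fin.cons_succ]
        push_cast
        module
  refine ⟨x, s, hs, hκs, fun y => ?_, fun y => ?_⟩
  · have h1 := norm_sq_le_barrierPotential_mul hv hiso hM y
    have h0 := hM.self_nonneg y
    rw [← hM.symm, re_inner_smul_id_add_sum_rankOne] at h0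
    rw [re_inner_smul_id_add_sum_rankOne] at h1
    have h2 := h1.trans (mul_le_mul_of_nonneg_right hMp h0)
    rw [← div_le_iff₀' hεL] at h2
    have h3 : 1 / εL * ‖y‖ ^ 2 = ‖y‖ ^ 2 / εL := one_div_mul_eq_div _ _
    nlinarith
  · have h0 := hN.self_nonneg y
    rw [← hN.symm, re_inner_smul_id_add_sum_rankOne] at h0
    simp only [neg_mul, Finset.sum_neg_distrib] at h0
    linarith

/-- Discretization of a tight frame `v` of trace at most `m` with simultaneous control of `h`. -/
theorem exists_weighted_points [CompleteSpace E] [CompleteSpace F] [Nontrivial E]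
    {v : D → E} (hv : MemLp v 2 μ) (hiso : ∀ y, ∫ x, ‖⟪v x, y⟫_𝕜‖ ^ 2 ∂μ = ‖y‖ ^ 2)
    {h : D → F} (hh : MemLp h 2 μ) {σ : ℝ} (hσ : 0 < σ)
    (hbd : ∀ y, ∫ x, ‖⟪h x, y⟫_𝕜‖ ^ 2 ∂μ ≤ σ ^ 2 * ‖y‖ ^ 2)
    {m S : ℝ} (hm : 0 < m) (hvm : ∫ x, ‖v x‖ ^ 2 ∂μ ≤ m) (hS : 0 < S)
    (hhS : ∫ x, ‖h x‖ ^ 2 ∂μ ≤ S)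
    {α κ : ℝ} (hα : 0 < α) (hκ : 0 ≤ κ) (hκi : Integrable (fun _ : D => κ) μ)
    (hακ : α + ∫ _, κ ∂μ ≤ 1) {n : ℕ} (hn : 0 < n) (hmn : m < n + 1) :
    ∃ (x : Fin n → D) (s : Fin n → ℝ), (∀ i, 0 < s i) ∧ (∀ i, κ * s i ≤ 1) ∧
      (∀ y, (√(n + 1) - √m) ^ 2 * ‖y‖ ^ 2 ≤ ∑ i, s i * ‖⟪v (x i), y⟫_𝕜‖ ^ 2) ∧
      (∀ y, α * ∑ i, s i * ‖⟪h (x i), y⟫_𝕜‖ ^ 2 ≤ (√S + √(n + 1) * σ) ^ 2 * ‖y‖ ^ 2) := by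
  have hn' : (0 : ℝ) < n := by exact_mod_cast hn
  set a := √((n : ℝ) + 1) with ha
  set b := √m with hb
  set c := √S with hc
  have ha0 : 0 < a := Real.sqrt_pos.2 (by linarith)
  have hb0 : 0 < b := Real.sqrt_pos.2 hm
  have hc0 : 0 < c := Real.sqrt_pos.2 hS
  have haa : (n : ℝ) + 1 = a ^ 2 := (Real.sq_sqrt (by linarith)).symm
  have hbb : m = b ^ 2 := (Real.sq_sqrt hm.le).symm
  have hcc : S = c ^ 2 := (Real.sq_sqrt hS.le).symm
  have hab : b < a := Real.sqrt_lt_sqrt hm.le hmn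
  have hn1 : (n : ℝ) = a ^ 2 - 1 := by linarith
  have hab' : 0 < a - b := by linarith
  have hp : 0 < b * (a - b) := by positivity
  have hδU : 0 < σ * (σ + c / a) * (a ^ 2 / n) / α := by positivity
  -- The starting barriers `p` and `u` make the initial potential bounds hold, and 1/δL - εL = 1 is
  -- the total budget, of which α goes to the upper barrier and ∫ κ to the weight cap. The factor
  -- a²/n = (n+1)/n in δU makes the budget strict; n such steps contribute as n + 1 plain ones.
  obtain ⟨x, s, hs, hκs, h1, h2⟩ := exists_points_of_barriers hv hiso hh hbd hκ hκi
    (εL := b / (a - b)) (δL := (a - b) / a) (p := b * (a - b))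
    (εU := α * c / (c + a * σ)) (u := c * (c + a * σ) / α)
    (by positivity) hδU (by positivity)
    (by rw [div_mul_div_comm, div_lt_one (by positivity)]; nlinarith) hp (by positivity)
    (hvm.trans (by rw [hbb]; apply le_of_eq; field_simp))
    (hhS.trans (by rw [hcc]; apply le_of_eq; field_simp))
    (by
      have e1 : 1 / ((a - b) / a) - b / (a - b) = 1 := by field_simp
      have e2 : σ ^ 2 / (σ * (σ + c / a) * (a ^ 2 / n) / α) =
          α * (n / a ^ 2 * (a * σ) / (c + a * σ)) := by field_simp; ring
      have e3 : (n : ℝ) / a ^ 2 < 1 := by rw [div_lt_one (by positivity)]; linarith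
      have e4 : n / a ^ 2 * (a * σ) / (c + a * σ) + c / (c + a * σ) < 1 := by
        rw [← add_div, div_lt_one (by positivity)]
        nlinarith [mul_pos ha0 hσ]
      have e5 := mul_lt_mul_of_pos_left e4 hα
      rw [e1, e2]
      rw [mul_add, mul_one, ← mul_div_assoc α c] at e5
      linarith) n
  refine ⟨x, s, hs, hκs, fun y => le_trans ?_ (h1 y), fun y => ?_⟩
  · refine mul_le_mul_of_nonneg_right ?_ (by positivity)
    have e1 : 1 / (b / (a - b)) - b * (a - b) + n * ((a - b) / a) - (a - b) ^ 2 =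
        (a - b) ^ 2 / (a * b) := by
      rw [hn1]; field_simp; ring
    have : 0 ≤ (a - b) ^ 2 / (a * b) := by positivity
    linarith
  · have e1 : α * (c * (c + a * σ) / α + n * (σ * (σ + c / a) * (a ^ 2 / n) / α)) =
        (c + a * σ) ^ 2 := by field_simp; ring
    calc _ ≤ α * ((c * (c + a * σ) / α + n * (σ * (σ + c / a) * (a ^ 2 / n) / α)) * ‖y‖ ^ 2) :=
          mul_le_mul_of_nonneg_left (h2 y) hα.le
      _ = _ := by rw [← mul_assoc, e1]

end Sampling

/-! ### Weighted least squares as a linear projection. -/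

section LeastSquares

variable {D : Type*} {n : ℕ}

/-- The weighted sampling operator, an isometry for the discrete seminorm. -/
noncomputable def weightedSampling (x : Fin n → D) (w : Fin n → ℝ) :
    (D → ℂ) →ₗ[ℂ] EuclideanSpace ℂ (Fin n) where
  toFun f := WithLp.toLp 2 fun i => ((√(w i) : ℝ) : ℂ) * f (x i)
  map_add' f g := by ext i; simp [mul_add]
  map_smul' c f := by ext i; simp; ring

theorem norm_weightedSampling_sq (x : Fin n → D) {w : Fin n → ℝ} (hw : ∀ i, 0 < w i) (f : D → ℂ) :
    ‖weightedSampling x w f‖ ^ 2 = discreteNormSq x w f := by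
  rw [EuclideanSpace.norm_sq_eq]
  refine Finset.sum_congr rfl fun i _ => ?_
  simp only [weightedSampling, LinearMap.coe_mk, AddHom.coe_mk, norm_mul, mul_pow]
  rw [Complex.norm_real, Real.norm_eq_abs, sq_abs, Real.sq_sqrt (hw i).le]

theorem norm_sub_sq_starProjection {E : Type*} [NormedAddCommGroup E] [InnerProductSpace ℂ E]
    (R : Submodule ℂ E) [R.HasOrthogonalProjection] (y : E) {z : E} (hz : z ∈ R) :
    ‖y - z‖ ^ 2 = ‖y - R.starProjection y‖ ^ 2 + ‖R.starProjection y - z‖ ^ 2 := by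
  have h : ⟪y - R.starProjection y, R.starProjection y - z⟫_ℂ = 0 :=
    R.starProjection_inner_eq_zero y _ (R.sub_mem (R.starProjection_apply_mem y) hz)
  have e : y - z = (y - R.starProjection y) + (R.starProjection y - z) := by abel
  rw [e, norm_add_sq (𝕜 := ℂ), h]
  simp

/-- Weighted sampling is injective on V, so A is sampling, then orthogonal projection onto the
sampled copy of V, then a left inverse. Pythagoras gives the unique minimizer and contractivity in
the discrete seminorm; linearity in the samples serves the sampling numbers. -/
theorem exists_isLeastSquaresAlgorithm {H : Type*} [NormedAddCommGroup H] [InnerProductSpace ℂ H]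
    [RKHS ℂ H D ℂ] (V : Submodule ℂ H) (x : Fin n → D) {w : Fin n → ℝ} (hw : ∀ i, 0 < w i)
    (hV : ∀ g ∈ V, discreteNormSq x w (g : D → ℂ) = 0 → g = 0) :
    ∃ A : (D → ℂ) → H, IsLeastSquaresAlgorithm V x w A ∧
      (∃ φ : Fin n → H, ∀ f, A f = ∑ i, f (x i) • φ i) ∧
      (∀ f, A f ∈ V) ∧ (∀ f g, A (f + g) = A f + A g) ∧ (∀ g ∈ V, A (g : D → ℂ) = g) ∧
      ∀ f, discreteNormSq x w (A f : D → ℂ) ≤ discreteNormSq x w f := by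
  let Ev := weightedSampling x w
  let SH : H →ₗ[ℂ] EuclideanSpace ℂ (Fin n) := Ev ∘ₗ (RKHS.coeCLM (H := H) (X := D) ℂ).toLinearMap
  have hSH : ∀ g : H, SH g = Ev (g : D → ℂ) := fun g => rfl
  let SV : V →ₗ[ℂ] EuclideanSpace ℂ (Fin n) := SH ∘ₗ V.subtype
  have hker : LinearMap.ker SV = ⊥ := by
    rw [LinearMap.ker_eq_bot']
    intro g hg
    refine Subtype.ext (hV g g.2 ?_)
    rw [← norm_weightedSampling_sq x hw]
    have : Ev ((g : H) : D → ℂ) = 0 := hg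
    change ‖Ev _‖ ^ 2 = 0
    rw [this]; simp
  obtain ⟨L, hL⟩ := SV.exists_leftInverse_of_injective hker
  have hL' : ∀ k, L (SV k) = k := fun k => congrArg (fun T : V →ₗ[ℂ] V => T k) hL
  set R := LinearMap.range SV with hR
  let A₀ : EuclideanSpace ℂ (Fin n) →ₗ[ℂ] H := V.subtype ∘ₗ L ∘ₗ R.starProjection.toLinearMap
  have hA₀V : ∀ y, A₀ y ∈ V := fun y => (L (R.starProjection y)).2
  have hSA₀ : ∀ y, SH (A₀ y) = R.starProjection y := fun y => by
    obtain ⟨k, hk⟩ := R.starProjection_apply_mem y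
    change SV (L (R.starProjection y)) = _
    rw [← hk, hL']
  have hmem : ∀ g ∈ V, SH g ∈ R := fun g hg => ⟨⟨g, hg⟩, rfl⟩
  have hA₀S : ∀ g ∈ V, A₀ (SH g) = g := fun g hg => by
    change (L (R.starProjection (SH g)) : H) = g
    rw [R.starProjection_eq_self_iff.2 (hmem g hg)]
    exact congrArg Subtype.val (hL' ⟨g, hg⟩)
  have hdist : ∀ (f : D → ℂ) (g : H),
      discreteNormSq x w (f - (g : D → ℂ)) = ‖Ev f - SH g‖ ^ 2 := fun f g => by
    rw [hSH, ← map_sub, norm_weightedSampling_sq x hw]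
  refine ⟨fun f => A₀ (Ev f), fun f g => ⟨fun ⟨hg, hmin⟩ => ?_, ?_⟩,
    ⟨fun i => A₀ (EuclideanSpace.single i ((√(w i) : ℝ) : ℂ)), fun f => ?_⟩, fun f => hA₀V _,
    fun f g => by simp only [map_add], fun g hg => hA₀S g hg, fun f => ?_⟩
  · have h1 := hmin (hA₀V (Ev f))
    simp only [Set.mem_ofPred_eq, hdist] at h1
    rw [hSA₀, norm_sub_sq_starProjection R (Ev f) (hmem g hg)] at h1
    have h2 : ‖R.starProjection (Ev f) - SH g‖ = 0 := by
      have : 0 ≤ ‖R.starProjection (Ev f) - SH g‖ ^ 2 := by positivity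
      exact pow_eq_zero_iff two_ne_zero |>.1 (by linarith)
    rw [← hA₀S g hg, ← sub_eq_zero.1 (norm_eq_zero.1 h2)]
    change (L (R.starProjection (R.starProjection (Ev f))) : H) = (L (R.starProjection (Ev f)) : H)
    rw [R.starProjection_eq_self_iff.2 (R.starProjection_apply_mem _)]
  · rintro rfl
    refine ⟨hA₀V _, fun k hk => ?_⟩
    simp only [Set.mem_ofPred_eq, hdist]
    rw [hSA₀, norm_sub_sq_starProjection R (Ev f) (hmem k hk)]
    have : 0 ≤ ‖R.starProjection (Ev f) - SH k‖ ^ 2 := by positivity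
    linarith
  · have : Ev f = ∑ i, f (x i) • EuclideanSpace.single i ((√(w i) : ℝ) : ℂ) := by
      ext j
      simp [Ev, weightedSampling, mul_comm, Finset.sum_apply, Pi.single_apply]
    simp only [this, map_sum, map_smul]
  · rw [← norm_weightedSampling_sq x hw, ← norm_weightedSampling_sq x hw]
    change ‖SH (A₀ (Ev f))‖ ^ 2 ≤ _
    rw [hSA₀]
    gcongr
    exact R.norm_starProjection_apply_le _

end LeastSquares

/-! ### Representers of point evaluation. -/

section Representer

variable {D : Type*} {H : Type*} [NormedAddCommGroup H] [InnerProductSpace ℂ H] [RKHS ℂ H D ℂ]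
  [CompleteSpace H]

variable (H) in
/-- The representer of point evaluation at `x`. -/
noncomputable def evalRepresenter (x : D) : H := RKHS.kerFun H x 1

theorem inner_evalRepresenter (x : D) (f : H) : ⟪evalRepresenter H x, f⟫_ℂ = f x := by
  simp [evalRepresenter]

theorem enorm_evalRepresenter_sq (x : D) :
    ‖evalRepresenter H x‖ₑ ^ 2 = ‖RKHS.kernel H x x (1 : ℂ)‖ₑ := by
  have h : RKHS.kernel H x x (1 : ℂ) = ((‖evalRepresenter H x‖ ^ 2 : ℝ) : ℂ) := by
    rw [← RKHS.kerFun_apply]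
    change (evalRepresenter H x) x = _
    rw [← inner_evalRepresenter, inner_self_eq_norm_sq_to_K]
    push_cast; rfl
  rw [h, ← ofReal_norm, ← ofReal_norm, ← ENNReal.ofReal_pow (norm_nonneg _), Complex.norm_real,
    Real.norm_of_nonneg (by positivity)]

end Representer

/-! ### The embedding into L₂ and its Hilbert–Schmidt norm. -/

section Embedding

variable {D : Type*} [MeasurableSpace D] {μ : Measure D}
  {H : Type*} [NormedAddCommGroup H] [InnerProductSpace ℂ H] [RKHS ℂ H D ℂ]
  {I : H →L[ℂ] Lp ℂ 2 μ}

namespace IsL2Embedding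

theorem memLp (hI : IsL2Embedding μ I) (f : H) : MemLp (f : D → ℂ) 2 μ :=
  (memLp_congr_ae (hI.coe_ae_eq f)).1 (Lp.memLp (I f))

theorem lintegral_enorm_sq (hI : IsL2Embedding μ I) (f : H) :
    ∫⁻ x, ‖f x‖ₑ ^ 2 ∂μ = ‖I f‖ₑ ^ 2 := by
  rw [Lp.enorm_def, eLpNorm_congr_ae (hI.coe_ae_eq f),
    eLpNorm_eq_lintegral_rpow_enorm_toReal two_ne_zero ENNReal.ofNat_ne_top]
  simp only [ENNReal.toReal_ofNat, ENNReal.rpow_ofNat]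
  rw [← ENNReal.rpow_natCast, ← ENNReal.rpow_mul]
  norm_num

theorem integral_norm_sq (hI : IsL2Embedding μ I) (f : H) :
    ∫ x, ‖f x‖ ^ 2 ∂μ = ‖I f‖ ^ 2 := by
  rw [integral_eq_lintegral_of_nonneg_ae (Filter.Eventually.of_forall fun x => by positivity)
    (integrable_norm_sq (hI.memLp f)).1]
  have : ∀ x, ENNReal.ofReal (‖f x‖ ^ 2) = ‖f x‖ₑ ^ 2 := fun x => by
    rw [ENNReal.ofReal_pow (norm_nonneg _), ofReal_norm]
  simp only [this]
  rw [hI.lintegral_enorm_sq]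
  simp

end IsL2Embedding

variable [CompleteSpace H]

/-- Bessel's inequality for the kernel, integrated: the trace of the kernel bounds the
Hilbert–Schmidt norm of the embedding. -/
theorem IsL2Embedding.tsum_enorm_sq_le (hI : IsL2Embedding μ I) {ι : Type*} {u : ι → H}
    (hu : Orthonormal ℂ u) :
    ∑' i, ‖I (u i)‖ₑ ^ 2 ≤ ∫⁻ x, ‖RKHS.kernel H x x (1 : ℂ)‖ₑ ∂μ := by
  rw [ENNReal.tsum_eq_iSup_sum]
  refine iSup_le fun s => ?_
  simp only [← hI.lintegral_enorm_sq]
  rw [← lintegral_finsetSum' s fun i _ => ((hI.memLp (u i)).1.enorm.pow_const 2)]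
  refine lintegral_mono fun x => ?_
  rw [← enorm_evalRepresenter_sq]
  have := hu.sum_inner_products_le (evalRepresenter H x) (s := s)
  have h2 := ENNReal.ofReal_le_ofReal this
  rw [ENNReal.ofReal_sum_of_nonneg fun i _ => by positivity, ENNReal.ofReal_pow (norm_nonneg _),
    ofReal_norm] at h2
  refine le_trans (le_of_eq (Finset.sum_congr rfl fun i _ => ?_)) h2
  rw [ENNReal.ofReal_pow (norm_nonneg _), norm_inner_symm, inner_evalRepresenter, ofReal_norm]

theorem HilbertBasis.hasSum_norm_inner_sq {ι E : Type*} [NormedAddCommGroup E]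
    [InnerProductSpace ℂ E] (b : HilbertBasis ι ℂ E) (z : E) :
    HasSum (fun i => ‖⟪b i, z⟫_ℂ‖ ^ 2) (‖z‖ ^ 2) := by
  have h := b.hasSum_inner_mul_inner z z
  have h2 := Complex.hasSum_re h
  convert h2 using 1
  · ext i
    rw [← inner_conj_symm z, RCLike.conj_mul]
    norm_cast
  · rw [inner_self_eq_norm_sq_to_K]; norm_cast

theorem HilbertBasis.enorm_sq_eq_tsum {ι E : Type*} [NormedAddCommGroup E]
    [InnerProductSpace ℂ E] (b : HilbertBasis ι ℂ E) (z : E) :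
    ‖z‖ₑ ^ 2 = ∑' i, ‖⟪b i, z⟫_ℂ‖ₑ ^ 2 := by
  have h := b.hasSum_norm_inner_sq z
  rw [← ofReal_norm, ← ENNReal.ofReal_pow (norm_nonneg _), ← h.tsum_eq,
    ENNReal.ofReal_tsum_of_nonneg (fun i => by positivity) h.summable]
  simp only [ENNReal.ofReal_pow (norm_nonneg _), ofReal_norm]

/-- The representer is the pointwise limit of its expansion in a countable basis, whose coefficients
are conjugated values of square-integrable functions. -/
theorem IsL2Embedding.aestronglyMeasurable_evalRepresenter (hI : IsL2Embedding μ I) {ι : Type*}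
    [Countable ι] (b : HilbertBasis ι ℂ H) : AEStronglyMeasurable (evalRepresenter H) μ := by
  refine aestronglyMeasurable_of_tendsto_ae (Filter.atTop : Filter (Finset ι))
    (f := fun s x => ∑ i ∈ s, (starRingEnd ℂ) (b i x) • b i) (fun s => ?_)
    (Filter.Eventually.of_forall fun x => ?_)
  · refine Finset.aestronglyMeasurable_fun_sum s fun i _ => ?_
    exact (Complex.continuous_conj.comp_aestronglyMeasurable (hI.memLp (b i)).1).smul_const _
  · have h := b.hasSum_repr (evalRepresenter H x)
    simp only [HilbertBasis.repr_apply_apply] at h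
    simp only [← inner_evalRepresenter, inner_conj_symm]
    exact h

/-- Parseval and Tonelli. With P a projection, this computes the trace of the frame operator of the
projected representers. -/
theorem IsL2Embedding.lintegral_enorm_map_evalRepresenter (hI : IsL2Embedding μ I) {ι : Type*}
    [Countable ι] (b : HilbertBasis ι ℂ H) {P : H →L[ℂ] H}
    (hP : ∀ x y, ⟪P x, y⟫_ℂ = ⟪x, P y⟫_ℂ) :
    ∫⁻ x, ‖P (evalRepresenter H x)‖ₑ ^ 2 ∂μ = ∑' i, ‖I (P (b i))‖ₑ ^ 2 := by
  simp only [← hI.lintegral_enorm_sq]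
  rw [← lintegral_tsum fun i => ((hI.memLp (P (b i))).1.enorm.pow_const 2)]
  refine lintegral_congr fun x => ?_
  rw [b.enorm_sq_eq_tsum]
  refine tsum_congr fun i => ?_
  rw [← hP, ← ofReal_norm, norm_inner_symm, inner_evalRepresenter, ofReal_norm]

end Embedding

/-! ### Coordinates on the singular space. -/

section Synthesis

variable {H : Type*} [NormedAddCommGroup H] [InnerProductSpace ℂ H] {σ : ℕ → ℝ} {e : ℕ → H}

instance finiteDimensional_singularSpace (m : ℕ) : FiniteDimensional ℂ (singularSpace σ e m) :=
  FiniteDimensional.span_of_finite ℂ ((Set.finite_Iio m).image _)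

/-- The singular functions with positive singular value, synthesized from coefficients. -/
noncomputable def synthesis (σ : ℕ → ℝ) (e : ℕ → H) (m : ℕ) :
    EuclideanSpace ℂ {k : Fin m // 0 < σ k} →ₗ[ℂ] H where
  toFun y := ∑ k, y k • singularFunction σ e k.1
  map_add' y z := by simp [add_smul, Finset.sum_add_distrib]
  map_smul' c y := by simp [mul_smul, Finset.smul_sum]

theorem synthesis_apply (m : ℕ) (y : EuclideanSpace ℂ {k : Fin m // 0 < σ k}) :
    synthesis σ e m y = ∑ k, y k • singularFunction σ e k.1 := rfl

end Synthesis

/-! ### Orthogonality and norm estimates for a singular system. -/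

section SingularSystem

variable {H : Type*} [NormedAddCommGroup H] [InnerProductSpace ℂ H] [CompleteSpace H]
  {Y : Type*} [NormedAddCommGroup Y] [InnerProductSpace ℂ Y] [CompleteSpace Y]
  {I : H →L[ℂ] Y} {σ : ℕ → ℝ} {e : ℕ → H}

namespace IsSingularSystem

theorem pos_of_ne_zero (h : IsSingularSystem I σ e) {k : ℕ} (hk : σ k ≠ 0) : 0 < σ k :=
  lt_of_le_of_ne (h.nonneg k) (Ne.symm hk)

theorem inner_eq (h : IsSingularSystem I σ e) (j k : ℕ) :
    ⟪e j, e k⟫_ℂ = if j = k ∧ 0 < σ j then 1 else 0 := by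
  by_cases hj : 0 < σ j
  · by_cases hk : 0 < σ k
    · have := (orthonormal_iff_ite.1 h.orthonormal) ⟨j, hj⟩ ⟨k, hk⟩
      simpa [hj] using this
    · have hk0 : σ k = 0 := le_antisymm (not_lt.1 hk) (h.nonneg k)
      have : j ≠ k := by rintro rfl; exact hk hj
      simp [h.eq_zero k hk0, this]
  · have hj0 : σ j = 0 := le_antisymm (not_lt.1 hj) (h.nonneg j)
    simp [h.eq_zero j hj0, hj]

theorem inner_map_left (h : IsSingularSystem I σ e) (k : ℕ) (z : H) :
    ⟪I (e k), I z⟫_ℂ = (σ k : ℂ) ^ 2 * ⟪e k, z⟫_ℂ := by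
  rw [← ContinuousLinearMap.adjoint_inner_left, h.eigen, inner_smul_left]
  simp

theorem span_pos_eq (h : IsSingularSystem I σ e) :
    Submodule.span ℂ (Set.range fun k : {k : ℕ // 0 < σ k} => e k) =
      Submodule.span ℂ (Set.range e) := by
  refine le_antisymm (Submodule.span_mono ?_) (Submodule.span_le.2 ?_)
  · rintro _ ⟨k, rfl⟩; exact ⟨k, rfl⟩
  · rintro _ ⟨k, rfl⟩
    by_cases hk : σ k = 0
    · rw [h.eq_zero k hk]; exact Submodule.zero_mem _
    · exact Submodule.subset_span ⟨⟨k, h.pos_of_ne_zero hk⟩, rfl⟩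

/-- The Hilbert basis of the singular vectors with positive singular value. -/
noncomputable def hilbertBasis (h : IsSingularSystem I σ e) :
    HilbertBasis {k : ℕ // 0 < σ k} ℂ H :=
  HilbertBasis.mk h.orthonormal (by rw [h.span_pos_eq, h.complete])

theorem hilbertBasis_apply (h : IsSingularSystem I σ e) (k : {k : ℕ // 0 < σ k}) :
    h.hilbertBasis k = e k := by
  simp [hilbertBasis]

theorem norm_map_sq (h : IsSingularSystem I σ e) (k : ℕ) : ‖I (e k)‖ ^ 2 = σ k ^ 2 := by
  have h1 := congrArg RCLike.re (h.inner_map_left k (e k))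
  rw [h.inner_eq, inner_self_eq_norm_sq] at h1
  by_cases hk : σ k = 0
  · simp [h.eq_zero k hk, hk]
  · rw [h1]
    simp [h.pos_of_ne_zero hk, ← Complex.ofReal_pow]

theorem mem_singularSpace (h : IsSingularSystem I σ e) {m k : ℕ} (hk : k < m) :
    e k ∈ singularSpace σ e m := by
  by_cases hk0 : σ k = 0
  · rw [h.eq_zero k hk0]; exact Submodule.zero_mem _
  · have : e k = (σ k : ℂ) • singularFunction σ e k := by
      rw [singularFunction, smul_smul, mul_inv_cancel₀ (by exact_mod_cast hk0), one_smul]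
    rw [this]
    exact Submodule.smul_mem _ _ (Submodule.subset_span ⟨k, hk, rfl⟩)

theorem mem_orthogonal_singularSpace (h : IsSingularSystem I σ e) {m k : ℕ} (hk : m ≤ k) :
    e k ∈ (singularSpace σ e m)ᗮ := by
  rw [Submodule.mem_orthogonal]
  intro u hu
  induction hu using Submodule.span_induction with
  | mem u hu =>
    obtain ⟨j, hj, rfl⟩ := hu
    have hjk : j ≠ k := (lt_of_lt_of_le hj hk).ne
    simp [singularFunction, inner_smul_left, h.inner_eq, hjk]
  | zero => simp
  | add x y _ _ hx hy => rw [inner_add_left, hx, hy, add_zero]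
  | smul c x _ hx => rw [inner_smul_left, hx, mul_zero]

theorem norm_map_sq_hasSum (h : IsSingularSystem I σ e) (z : H) :
    HasSum (fun k : {k : ℕ // 0 < σ k} => σ k ^ 2 * ‖⟪e k, z⟫_ℂ‖ ^ 2) (‖I z‖ ^ 2) := by
  have h1 := Complex.hasSum_re (h.hilbertBasis.hasSum_inner_mul_inner
    (ContinuousLinearMap.adjoint I (I z)) z)
  convert h1 using 1
  · ext k
    rw [h.hilbertBasis_apply, ContinuousLinearMap.adjoint_inner_left, ← inner_conj_symm (I z),
      h.inner_map_left, map_mul, mul_assoc, RCLike.conj_mul]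
    simp only [map_pow, Complex.conj_ofReal]
    rw [← Complex.ofReal_pow, Complex.re_ofReal_mul]
    norm_cast
  · rw [ContinuousLinearMap.adjoint_inner_left, inner_self_eq_norm_sq_to_K]
    norm_cast

theorem norm_map_le (h : IsSingularSystem I σ e) {m : ℕ} {z : H}
    (hz : z ∈ (singularSpace σ e m)ᗮ) : ‖I z‖ ≤ σ m * ‖z‖ := by
  refine abs_le_of_sq_le_sq' ?_ (mul_nonneg (h.nonneg m) (norm_nonneg _)) |>.2
  rw [mul_pow]
  have h2 := (h.hilbertBasis.hasSum_norm_inner_sq z).mul_left (σ m ^ 2)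
  refine hasSum_le (fun k => ?_) (h.norm_map_sq_hasSum z) h2
  rw [h.hilbertBasis_apply]
  by_cases hk : k.1 < m
  · rw [(Submodule.mem_orthogonal _ _).1 hz _ (h.mem_singularSpace hk)]; simp
  · have := h.antitone (not_lt.1 hk)
    have := h.nonneg k
    gcongr

/-- `V_m` is spanned by eigenvectors of I* I, so H-orthogonality to it passes to L₂. This yields the
factor √2 instead of 2 in the error bound. -/
theorem inner_map_map_eq_zero (h : IsSingularSystem I σ e) {m : ℕ} {g z : H}
    (hg : g ∈ singularSpace σ e m) (hz : z ∈ (singularSpace σ e m)ᗮ) : ⟪I g, I z⟫_ℂ = 0 := by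
  induction hg using Submodule.span_induction with
  | mem u hu =>
    obtain ⟨j, hj, rfl⟩ := hu
    simp only [singularFunction, map_smul, inner_smul_left, h.inner_map_left,
      (Submodule.mem_orthogonal _ _).1 hz _ (h.mem_singularSpace hj), mul_zero]
  | zero => simp
  | add x y _ _ hx hy => rw [map_add, inner_add_left, hx, hy, add_zero]
  | smul c x _ hx => rw [map_smul, inner_smul_left, hx, mul_zero]

theorem eq_zero_of_mem_orthogonal (h : IsSingularSystem I σ e) (hI : Function.Injective I) {m : ℕ}
    (hm : σ m = 0) {z : H} (hz : z ∈ (singularSpace σ e m)ᗮ) : z = 0 := by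
  have := h.norm_map_le hz
  rw [hm, zero_mul] at this
  exact hI (by rw [norm_le_zero_iff.1 this, map_zero])

theorem orthonormal_singularFunction (h : IsSingularSystem I σ e) (m : ℕ) :
    Orthonormal ℂ fun k : {k : Fin m // 0 < σ k} => I (singularFunction σ e k.1) := by
  rw [orthonormal_iff_ite]
  rintro ⟨j, hj⟩ ⟨k, hk⟩
  have hj' : (σ j : ℂ) ≠ 0 := by exact_mod_cast hj.ne'
  simp only [singularFunction, map_smul, inner_smul_left, inner_smul_right, h.inner_map_left,
    h.inner_eq, hj, and_true, map_inv₀, Complex.conj_ofReal, Subtype.mk.injEq, Fin.val_inj]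
  split_ifs with hjk
  · subst hjk; field_simp
  · simp

theorem norm_map_synthesis (h : IsSingularSystem I σ e) (m : ℕ)
    (y : EuclideanSpace ℂ {k : Fin m // 0 < σ k}) : ‖I (synthesis σ e m y)‖ ^ 2 = ‖y‖ ^ 2 := by
  rw [synthesis_apply, map_sum]
  simp only [map_smul]
  have := (h.orthonormal_singularFunction m).inner_sum y y Finset.univ
  rw [EuclideanSpace.norm_sq_eq]
  have h2 : ∑ i, (starRingEnd ℂ) (y i) * y i = ((∑ i, ‖y i‖ ^ 2 : ℝ) : ℂ) := by
    push_cast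
    exact Finset.sum_congr rfl fun i _ => RCLike.conj_mul _
  rw [h2] at this
  have h3 := congrArg RCLike.re this
  rwa [inner_self_eq_norm_sq, RCLike.re_eq_complex_re, Complex.ofReal_re] at h3

theorem exists_synthesis_eq (h : IsSingularSystem I σ e) {m : ℕ} {g : H}
    (hg : g ∈ singularSpace σ e m) : ∃ y, synthesis σ e m y = g := by
  have : singularSpace σ e m ≤ LinearMap.range (synthesis σ e m) := by
    refine Submodule.span_le.2 ?_
    rintro _ ⟨k, hk, rfl⟩
    by_cases hk0 : σ k = 0
    · rw [singularFunction, h.eq_zero k hk0, smul_zero]; exact Submodule.zero_mem _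
    · refine ⟨EuclideanSpace.single ⟨⟨k, hk⟩, h.pos_of_ne_zero hk0⟩ 1, ?_⟩
      rw [synthesis_apply, Finset.sum_eq_single ⟨⟨k, hk⟩, h.pos_of_ne_zero hk0⟩]
      · simp
      · intro b _ hb; simp [hb]
      · simp
  exact this hg

end IsSingularSystem

end SingularSystem

/-! ### Point evaluation on the singular space as a frame. -/

section PointEvaluation

variable {D : Type*} {H : Type*} [NormedAddCommGroup H] [InnerProductSpace ℂ H] [RKHS ℂ H D ℂ]
  {σ : ℕ → ℝ} {e : ℕ → H}

theorem discreteNormSq_coe_zero {n : ℕ} (x : Fin n → D) (w : Fin n → ℝ) :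
    discreteNormSq x w ((0 : H) : D → ℂ) = 0 := by
  simp [discreteNormSq]

/-- The coefficient vector representing point evaluation at `x` on the singular space. -/
noncomputable def evalCoefficients (σ : ℕ → ℝ) (e : ℕ → H) (m : ℕ) (x : D) :
    EuclideanSpace ℂ {k : Fin m // 0 < σ k} :=
  ∑ k, (starRingEnd ℂ) (singularFunction σ e k.1 x) • EuclideanSpace.single k 1

theorem inner_evalCoefficients (m : ℕ) (x : D) (y : EuclideanSpace ℂ {k : Fin m // 0 < σ k}) :
    ⟪evalCoefficients σ e m x, y⟫_ℂ = (synthesis σ e m y) x := by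
  have h : (synthesis σ e m y) x = ∑ k, y k * singularFunction σ e k.1 x := by
    rw [← RKHS.coeCLM_apply, synthesis_apply, map_sum]
    simp
  rw [h, evalCoefficients, sum_inner]
  refine Finset.sum_congr rfl fun k _ => ?_
  rw [inner_smul_left, EuclideanSpace.inner_single_left, Complex.conj_conj, map_one, one_mul,
    mul_comm]

theorem memLp_evalCoefficients [MeasurableSpace D] {μ : Measure D} {I : H →L[ℂ] Lp ℂ 2 μ}
    (hI : IsL2Embedding μ I) (m : ℕ) :
    MemLp (evalCoefficients σ e m) 2 μ := by
  unfold evalCoefficients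
  refine memLp_finsetSum _ fun k _ => ?_
  exact (ContinuousLinearMap.toSpanSingleton ℂ (EuclideanSpace.single k (1 : ℂ))).comp_memLp'
    (hI.memLp (singularFunction σ e k.1)).star

end PointEvaluation

/-! ### Simultaneous discretization on the singular space and its complement. -/

section Discretization

variable {D : Type*} [MeasurableSpace D] {μ : Measure D}
  {H : Type*} [NormedAddCommGroup H] [InnerProductSpace ℂ H] [CompleteSpace H] [RKHS ℂ H D ℂ]
  {I : H →L[ℂ] Lp ℂ 2 μ} {σ : ℕ → ℝ} {e : ℕ → H}

theorem enorm_sq_eq_ofReal {E : Type*} [NormedAddCommGroup E] (z : E) :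
    ‖z‖ₑ ^ 2 = ENNReal.ofReal (‖z‖ ^ 2) := by
  rw [ENNReal.ofReal_pow (norm_nonneg _), ofReal_norm]

theorem memLp_two_of_lintegral_enorm_sq_le {E : Type*} [NormedAddCommGroup E] {f : D → E}
    (hf : AEStronglyMeasurable f μ) {S : ℝ} (hS : ∫⁻ x, ‖f x‖ₑ ^ 2 ∂μ ≤ ENNReal.ofReal S) :
    MemLp f 2 μ := by
  refine ⟨hf, (eLpNorm_lt_top_iff_lintegral_rpow_enorm_lt_top two_ne_zero
    ENNReal.ofNat_ne_top).2 ?_⟩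
  simp only [ENNReal.toReal_ofNat, ENNReal.rpow_ofNat]
  exact hS.trans_lt ENNReal.ofReal_lt_top

theorem integral_norm_sq_le_of_lintegral {E : Type*} [NormedAddCommGroup E] {f : D → E}
    (hf : AEStronglyMeasurable f μ) {S : ℝ} (hS0 : 0 ≤ S)
    (hS : ∫⁻ x, ‖f x‖ₑ ^ 2 ∂μ ≤ ENNReal.ofReal S) : ∫ x, ‖f x‖ ^ 2 ∂μ ≤ S := by
  rw [integral_eq_lintegral_of_nonneg_ae (Filter.Eventually.of_forall fun x => by positivity)
    (integrable_norm_sq (memLp_two_of_lintegral_enorm_sq_le hf hS)).1]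
  simp only [← enorm_sq_eq_ofReal]
  exact ENNReal.toReal_le_of_le_ofReal hS0 hS

namespace IsSingularSystem

theorem summable_sq (hI : IsL2Embedding μ I) (htr : HasFiniteTrace μ H)
    (h : IsSingularSystem I σ e) : Summable fun k => σ k ^ 2 := by
  have h1 := (hI.tsum_enorm_sq_le h.orthonormal).trans_lt htr
  have h2 := ENNReal.summable_toReal h1.ne
  have h3 : Summable ((fun k => σ k ^ 2) ∘ ((↑) : {k : ℕ // 0 < σ k} → ℕ)) := by
    refine h2.congr fun k => ?_
    rw [ENNReal.toReal_pow, toReal_enorm, h.norm_map_sq]; rfl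
  refine (Function.Injective.summable_iff Subtype.val_injective fun k hk => ?_).1 h3
  have : σ k = 0 := by
    by_contra h0
    exact hk ⟨⟨k, h.pos_of_ne_zero h0⟩, rfl⟩
  simp [this]

theorem lintegral_enorm_projection_le (hI : IsL2Embedding μ I) (htr : HasFiniteTrace μ H)
    (h : IsSingularSystem I σ e) (m : ℕ) :
    ∫⁻ x, ‖(singularSpace σ e m)ᗮ.starProjection (evalRepresenter H x)‖ₑ ^ 2 ∂μ ≤
      ENNReal.ofReal (∑' k, σ (m + k) ^ 2) := by
  rw [hI.lintegral_enorm_map_evalRepresenter h.hilbertBasis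
    (fun x y => Submodule.inner_starProjection_left_eq_right _ x y)]
  let g : ℕ → ℝ≥0∞ := fun k => if m ≤ k then ENNReal.ofReal (σ k ^ 2) else 0
  calc ∑' i, ‖I ((singularSpace σ e m)ᗮ.starProjection (h.hilbertBasis i))‖ₑ ^ 2
      ≤ ∑' i : {k : ℕ // 0 < σ k}, g i := by
        refine ENNReal.tsum_le_tsum fun i => ?_
        rw [h.hilbertBasis_apply]
        by_cases hi : m ≤ i
        · rw [Submodule.starProjection_eq_self_iff.2 (h.mem_orthogonal_singularSpace hi),
            enorm_sq_eq_ofReal, h.norm_map_sq]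
          simp [g, hi]
        · have : (singularSpace σ e m)ᗮ.starProjection (e i) = 0 :=
            (Submodule.starProjection_apply_eq_zero_iff _).2
              (Submodule.le_orthogonal_orthogonal _ (h.mem_singularSpace (not_le.1 hi)))
          rw [this]; simp
    _ ≤ ∑' k, g k := ENNReal.tsum_comp_le_tsum_of_injective Subtype.val_injective g
    _ = ∑' k, g (k + m) := by
        rw [← ENNReal.summable.sum_add_tsum_nat_add' (f := g) (k := m), Finset.sum_eq_zero, zero_add]
        intro i hi
        simp [g, Finset.mem_range.1 hi]
    _ = ENNReal.ofReal (∑' k, σ (m + k) ^ 2) := by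
        rw [ENNReal.ofReal_tsum_of_nonneg (fun k => by positivity)]
        · exact tsum_congr fun k => by simp [g, add_comm]
        · simpa only [add_comm] using
            (summable_nat_add_iff (f := fun k => σ k ^ 2) m).2 (h.summable_sq hI htr)

theorem integral_norm_inner_evalCoefficients_sq (hI : IsL2Embedding μ I)
    (h : IsSingularSystem I σ e) (m : ℕ) (y : EuclideanSpace ℂ {k : Fin m // 0 < σ k}) :
    ∫ x, ‖⟪evalCoefficients σ e m x, y⟫_ℂ‖ ^ 2 ∂μ = ‖y‖ ^ 2 := by
  simp only [inner_evalCoefficients]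
  rw [hI.integral_norm_sq, h.norm_map_synthesis]

theorem integral_norm_evalCoefficients_sq_le (hI : IsL2Embedding μ I)
    (h : IsSingularSystem I σ e) (m : ℕ) : ∫ x, ‖evalCoefficients σ e m x‖ ^ 2 ∂μ ≤ m := by
  have hx : ∀ x, ‖evalCoefficients σ e m x‖ ^ 2 =
      ∑ k, ‖⟪evalCoefficients σ e m x, EuclideanSpace.single k (1 : ℂ)⟫_ℂ‖ ^ 2 := by
    intro x
    rw [EuclideanSpace.norm_sq_eq]
    refine Finset.sum_congr rfl fun k _ => ?_
    rw [norm_inner_symm, EuclideanSpace.inner_single_left, map_one, one_mul]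
  simp only [hx]
  rw [integral_finsetSum _ fun k _ => integrable_norm_inner_sq (memLp_evalCoefficients hI m) _]
  simp only [h.integral_norm_inner_evalCoefficients_sq hI, PiLp.norm_single, norm_one, one_pow,
    Finset.sum_const, nsmul_eq_mul, mul_one, Finset.card_univ]
  exact_mod_cast (Fintype.card_subtype_le _).trans (Fintype.card_fin m).le

/-- Points and weights for which the discrete seminorm dominates the `L₂` norm on the singular space
and is dominated by the norm of `H` on its orthogonal complement. -/
theorem exists_discretization [Nonempty D] (hI : IsL2Embedding μ I) (htr : HasFiniteTrace μ H)
    (h : IsSingularSystem I σ e) {m n : ℕ} (hm : 1 ≤ m) (hmn : m ≤ n)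
    {α κ : ℝ} (hα : 0 < α) (hκ : 0 ≤ κ) (hκi : Integrable (fun _ : D => κ) μ)
    (hακ : α + ∫ _, κ ∂μ ≤ 1) :
    ∃ (x : Fin n → D) (w : Fin n → ℝ), (∀ i, 0 < w i) ∧ (∀ i, κ * (w i * (n + 1)) ≤ 1) ∧
      (∀ g ∈ singularSpace σ e m,
        (√(n + 1) - √m) ^ 2 * ‖I g‖ ^ 2 ≤ (n + 1) * discreteNormSq x w (g : D → ℂ)) ∧
      (∀ z ∈ (singularSpace σ e m)ᗮ, α * ((n + 1) * discreteNormSq x w (z : D → ℂ)) ≤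
        (√(∑' k, σ (m + k) ^ 2) + √(n + 1) * σ m) ^ 2 * ‖z‖ ^ 2) := by
  have hn1 : (0 : ℝ) < n + 1 := by positivity
  -- Here H = 0 and the coefficient space is trivial, which the barrier method excludes; any weight
  -- below the cap works.
  by_cases h0 : σ 0 = 0
  · have hz : ∀ z : H, z = 0 := fun z =>
      h.eq_zero_of_mem_orthogonal hI.injective (m := 0) h0 (by simp [singularSpace])
    obtain ⟨x₀⟩ := ‹Nonempty D›
    have hc : 0 < ((n + 1) * (κ + 1))⁻¹ := by positivity
    refine ⟨fun _ => x₀, fun _ => ((n + 1) * (κ + 1))⁻¹, fun _ => hc, fun _ => ?_,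
      fun g _ => ?_, fun z _ => ?_⟩
    · have : κ * (((n + 1) * (κ + 1))⁻¹ * ((n : ℝ) + 1)) = κ / (κ + 1) := by field_simp
      rw [this, div_le_one (by positivity)]; linarith
    · rw [hz g, discreteNormSq_coe_zero]; simp
    · rw [hz z, discreteNormSq_coe_zero]; simp
  have hσ0 := h.pos_of_ne_zero h0
  have hne : Nonempty {k : Fin m // 0 < σ k} := ⟨⟨⟨0, hm⟩, hσ0⟩⟩
  have hv := memLp_evalCoefficients (σ := σ) (e := e) hI m
  have hiso : ∀ y, ∫ x, ‖⟪evalCoefficients σ e m x, y⟫_ℂ‖ ^ 2 ∂μ = ‖y‖ ^ 2 :=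
    h.integral_norm_inner_evalCoefficients_sq hI m
  have hvm : ∫ x, ‖evalCoefficients σ e m x‖ ^ 2 ∂μ ≤ m :=
    h.integral_norm_evalCoefficients_sq_le hI m
  have hm0 : (0 : ℝ) < m := by exact_mod_cast hm
  have hmn' : (m : ℝ) < n + 1 := by
    have : (m : ℝ) ≤ n := by exact_mod_cast hmn
    linarith
  set Q := (singularSpace σ e m)ᗮ.starProjection with hQ
  set S := ∑' k, σ (m + k) ^ 2 with hSdef
  obtain ⟨x, s, hs, hκs, h1, h2⟩ : ∃ (x : Fin n → D) (s : Fin n → ℝ), (∀ i, 0 < s i) ∧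
      (∀ i, κ * s i ≤ 1) ∧
      (∀ y, (√(n + 1) - √m) ^ 2 * ‖y‖ ^ 2 ≤ ∑ i, s i * ‖⟪evalCoefficients σ e m (x i), y⟫_ℂ‖ ^ 2) ∧
      (∀ z ∈ (singularSpace σ e m)ᗮ, α * ∑ i, s i * ‖z (x i)‖ ^ 2 ≤
        (√S + √(n + 1) * σ m) ^ 2 * ‖z‖ ^ 2) := by
    -- The complement of `V_m` is zero, so only the lower bound matters. The barrier method needs
    -- positive σ and S, hence the dummy family h = 0 with σ = S = 1.
    by_cases hm' : σ m = 0
    · obtain ⟨x, s, hs, hκs, h1, -⟩ := exists_weighted_points (F := EuclideanSpace ℂ (Fin 1)) hv hiso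
        (h := fun _ => 0) MemLp.zero (σ := 1) one_pos (fun y => by simp) hm0 hvm (S := 1) one_pos (by simp)
        hα hκ hκi hακ (hm.trans hmn) hmn'
      refine ⟨x, s, hs, hκs, h1, fun z hz => ?_⟩
      rw [h.eq_zero_of_mem_orthogonal hI.injective hm' hz]
      simp
    · have hσm := h.pos_of_ne_zero hm'
      have hsum : Summable fun k => σ (m + k) ^ 2 := by
        simpa only [add_comm] using
          (summable_nat_add_iff (f := fun k => σ k ^ 2) m).2 (h.summable_sq hI htr)
      have hS : 0 < S := hsum.tsum_pos (fun k => by positivity) 0 (by simpa using by positivity)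
      have hmeas : AEStronglyMeasurable (fun x => Q (evalRepresenter H x)) μ :=
        Q.continuous.comp_aestronglyMeasurable
          (hI.aestronglyMeasurable_evalRepresenter h.hilbertBasis)
      have hQle := h.lintegral_enorm_projection_le hI htr m
      have hQi : ∀ x y, ⟪Q (evalRepresenter H x), y⟫_ℂ = (Q y) x := fun x y => by
        rw [hQ, Submodule.inner_starProjection_left_eq_right, inner_evalRepresenter]
      obtain ⟨x, s, hs, hκs, h1, h2⟩ := exists_weighted_points hv hiso
        (h := fun x => Q (evalRepresenter H x)) (memLp_two_of_lintegral_enorm_sq_le hmeas hQle)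
        hσm (fun y => by
          simp only [hQi]
          rw [hI.integral_norm_sq, ← mul_pow]
          gcongr
          refine (h.norm_map_le (Submodule.starProjection_apply_mem _ y)).trans ?_
          exact mul_le_mul_of_nonneg_left (Submodule.norm_starProjection_apply_le _ y) hσm.le)
        hm0 hvm hS (integral_norm_sq_le_of_lintegral hmeas hS.le hQle)
        hα hκ hκi hακ (hm.trans hmn) hmn'
      refine ⟨x, s, hs, hκs, h1, fun z hz => ?_⟩
      have := h2 z
      simp only [hQi] at this
      rwa [hQ, Submodule.starProjection_eq_self_iff.2 hz] at this
  have hdisc : ∀ f : D → ℂ, (n + 1) * discreteNormSq x (fun i => s i / (n + 1)) f =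
      ∑ i, s i * ‖f (x i)‖ ^ 2 := fun f => by
    rw [discreteNormSq, Finset.mul_sum]
    refine Finset.sum_congr rfl fun i _ => ?_
    field_simp
  refine ⟨x, fun i => s i / (n + 1), fun i => div_pos (hs i) hn1, fun i => ?_, fun g hg => ?_,
    fun z hz => ?_⟩
  · rw [div_mul_cancel₀ _ hn1.ne']; exact hκs i
  · obtain ⟨y, rfl⟩ := h.exists_synthesis_eq hg
    rw [hdisc, h.norm_map_synthesis]
    simpa only [inner_evalCoefficients] using h1 y
  · rw [hdisc]; exact h2 z hz

end IsSingularSystem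

end Discretization

/-! ### Error of least squares and linear sampling numbers. -/

section ErrorBound

variable {D : Type*} [MeasurableSpace D] {μ : Measure D}
  {H : Type*} [NormedAddCommGroup H] [InnerProductSpace ℂ H] [CompleteSpace H] [RKHS ℂ H D ℂ]
  {I : H →L[ℂ] Lp ℂ 2 μ} {σ : ℕ → ℝ} {e : ℕ → H}

theorem norm_sub_starProjection_eq_iInf {E : Type*} [NormedAddCommGroup E] [InnerProductSpace ℂ E]
    (V : Submodule ℂ E) [V.HasOrthogonalProjection] (f : E) :
    ‖f - V.starProjection f‖ = ⨅ g : V, ‖f - (g : E)‖ :=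
  (V.norm_eq_iInf_iff_inner_eq_zero (V.starProjection_apply_mem f)).2
    fun w hw => V.starProjection_inner_eq_zero f w hw

namespace IsSingularSystem

/-- Least squares on the singular space with the points and weights of `exists_discretization`. -/
theorem exists_leastSquares [Nonempty D] (hI : IsL2Embedding μ I) (htr : HasFiniteTrace μ H)
    (h : IsSingularSystem I σ e) {m n : ℕ} {r : ℝ} (hm : 1 ≤ m) (hmn : m ≤ n)
    (hr : r = ((n : ℝ) + 1) / m) {β κ : ℝ} (hβ : 1 ≤ β) (hκ : 0 ≤ κ)
    (hκi : Integrable (fun _ : D => κ) μ) (hβκ : (β ^ 2)⁻¹ + ∫ _, κ ∂μ ≤ 1) :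
    ∃ (x : Fin n → D) (w : Fin n → ℝ) (A : (D → ℂ) → H), (∀ i, 0 < w i) ∧
      (∀ i, κ * (w i * (n + 1)) ≤ 1) ∧
      (∀ g ∈ singularSpace σ e m, ‖I g‖ ≤ √r / (√r - 1) * √(discreteNormSq x w g)) ∧
      IsLeastSquaresAlgorithm (singularSpace σ e m) x w A ∧
      (∃ φ : Fin n → H, ∀ f, A f = ∑ i, f (x i) • φ i) ∧
      ∀ f : H, ‖I (f - A f)‖ ≤ β * (√(2 * r) / (√r - 1) *
        (σ m + √(1 / (r * m) * ∑' k, σ (m + k) ^ 2)) *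
          ⨅ g : singularSpace σ e m, ‖f - (g : H)‖) := by
  obtain ⟨x, w, hw, hκw, h1, h2⟩ := h.exists_discretization hI htr hm hmn
    (α := (β ^ 2)⁻¹) (by positivity) hκ hκi hβκ
  have hm0 : (0 : ℝ) < m := by exact_mod_cast hm
  have hn1 : (0 : ℝ) < n + 1 := by positivity
  have hmn' : (m : ℝ) < n + 1 := by
    have : (m : ℝ) ≤ n := by exact_mod_cast hmn
    linarith
  set S := ∑' k, σ (m + k) ^ 2 with hS
  have hS0 : 0 ≤ S := tsum_nonneg fun k => by positivity
  set V := singularSpace σ e m with hV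
  have hr1 : 1 < r := by rw [hr, lt_div_iff₀ hm0]; linarith
  have hr0 : 0 < r := by linarith
  set a := √((n : ℝ) + 1) with ha
  set b := √(m : ℝ) with hb
  have ha0 : 0 < a := Real.sqrt_pos.2 hn1
  have hb0 : 0 < b := Real.sqrt_pos.2 hm0
  have haa : (n : ℝ) + 1 = a ^ 2 := (Real.sq_sqrt hn1.le).symm
  have hab : b < a := Real.sqrt_lt_sqrt hm0.le hmn'
  have hrab : √r = a / b := by rw [hr, Real.sqrt_div hn1.le]
  have hsr : 1 < √r := Real.lt_sqrt_of_sq_lt (by linarith)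
  set C := √r / (√r - 1) with hC
  have hC' : C = a / (a - b) := by
    have : a - b ≠ 0 := by linarith
    rw [hC, hrab]; field_simp
  have hC1 : 1 ≤ C := by rw [hC, le_div_iff₀ (by linarith)]; linarith
  have hCsqrt : √(2 * r) / (√r - 1) = √2 * C := by
    rw [Real.sqrt_mul zero_le_two, hC, mul_div_assoc]
  set K := σ m + √(1 / (r * m) * S) with hK
  have hK0 : 0 ≤ K := add_nonneg (h.nonneg m) (Real.sqrt_nonneg _)
  have hrm : r * m = a ^ 2 := by rw [hr, div_mul_cancel₀ _ hm0.ne', haa]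
  have hK' : √S + a * σ m = a * K := by
    rw [hK, hrm, one_div_mul_eq_div, Real.sqrt_div hS0, Real.sqrt_sq ha0.le]
    field_simp; ring
  have hdisc0 : ∀ f : D → ℂ, 0 ≤ discreteNormSq x w f := fun f =>
    Finset.sum_nonneg fun i _ => mul_nonneg (hw i).le (by positivity)
  have hlow : ∀ g ∈ V, ‖I g‖ ≤ C * √(discreteNormSq x w g) := fun g hg => by
    have h3 := h1 g hg
    rw [haa] at h3
    refine abs_le_of_sq_le_sq' ?_ (by positivity) |>.2
    rw [mul_pow, Real.sq_sqrt (hdisc0 _), hC', div_pow, div_mul_eq_mul_div, le_div_iff₀]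
    · linarith
    · have : 0 < a - b := by linarith
      positivity
  have hupp : ∀ z ∈ Vᗮ, √(discreteNormSq x w z) ≤ β * K * ‖z‖ := fun z hz => by
    have h3 := h2 z hz
    rw [haa, hK', mul_pow, inv_mul_le_iff₀ (by positivity)] at h3
    refine Real.sqrt_le_iff.2 ⟨by positivity, ?_⟩
    have h4 : a ^ 2 * discreteNormSq x w z ≤ a ^ 2 * (β * K * ‖z‖) ^ 2 := by linarith
    exact le_of_mul_le_mul_left h4 (by positivity)
  obtain ⟨A, hA, hφ, hAV, hAadd, hAid, hAle⟩ := exists_isLeastSquaresAlgorithm V x hw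
    fun g hg h0 => hI.injective (by
      have := hlow g hg
      rw [h0, Real.sqrt_zero, mul_zero, norm_le_zero_iff] at this
      rw [this, map_zero])
  refine ⟨x, w, A, hw, hκw, hlow, hA, hφ, fun f => ?_⟩
  set z := f - V.starProjection f with hz
  have hzV : z ∈ Vᗮ := V.sub_starProjection_mem_orthogonal f
  -- A is additive and reproduces V, so the error depends only on z.
  have hAf : A f = V.starProjection f + A z := by
    have e1 : (f : D → ℂ) = (V.starProjection f : H) + (z : D → ℂ) := by
      rw [← RKHS.coe_add, hz]; congr 1; abel
    rw [e1, hAadd, hAid _ (V.starProjection_apply_mem f)]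
  have hsub : f - A f = z - A z := by rw [hAf, hz]; abel
  rw [← norm_sub_starProjection_eq_iInf, ← hz, hsub, hCsqrt, map_sub]
  have hI1 : ‖I z‖ ≤ C * (β * K * ‖z‖) := by
    have hσK : σ m ≤ K := le_add_of_nonneg_right (Real.sqrt_nonneg _)
    calc ‖I z‖ ≤ σ m * ‖z‖ := h.norm_map_le hzV
      _ ≤ K * ‖z‖ := by gcongr
      _ ≤ (C * β) * (K * ‖z‖) :=
        le_mul_of_one_le_left (by positivity) (one_le_mul_of_one_le_of_one_le hC1 hβ)
      _ = _ := by ring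
  have hI2 : ‖I (A z)‖ ≤ C * (β * K * ‖z‖) :=
    (hlow _ (hAV _)).trans (mul_le_mul_of_nonneg_left
      ((Real.sqrt_le_sqrt (hAle _)).trans (hupp z hzV)) (by linarith))
  -- Both terms have norm at most C β K ‖z‖; orthogonality lets their squares add.
  have horth : ⟪I z, I (A z)⟫_ℂ = 0 := by
    rw [← inner_conj_symm, h.inner_map_map_eq_zero (hAV _) hzV, map_zero]
  refine abs_le_of_sq_le_sq' ?_ (by positivity) |>.2
  rw [norm_sub_sq (𝕜 := ℂ), horth]
  have e2 : (β * (√2 * C * K * ‖z‖)) ^ 2 = 2 * (C * (β * K * ‖z‖)) ^ 2 := by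
    have : √(2 : ℝ) ^ 2 = 2 := Real.sq_sqrt zero_le_two
    calc _ = √(2 : ℝ) ^ 2 * (C * (β * K * ‖z‖)) ^ 2 := by ring
      _ = _ := by rw [this]
  rw [e2]
  have h3 := pow_le_pow_left₀ (norm_nonneg _) hI1 2
  have h4 := pow_le_pow_left₀ (norm_nonneg _) hI2 2
  simp only [map_zero, mul_zero, sub_zero]
  linarith

/-- Linear sampling numbers are bounded by the worst case error of least squares. -/
theorem linSamplingNumber_le [Nonempty D] (hI : IsL2Embedding μ I) (htr : HasFiniteTrace μ H)
    (h : IsSingularSystem I σ e) {m n : ℕ} (hm : 1 ≤ m) (hmn : m ≤ n) {c : ℝ}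
    (hc : √(2 * (((n : ℝ) + 1) / m)) / (√(((n : ℝ) + 1) / m) - 1) ≤ c) :
    linSamplingNumber n (unitBall D H) μ ≤
      ENNReal.ofReal (c * (σ m + √(1 / m * ∑' k, σ (m + k) ^ 2))) := by
  obtain ⟨x, w, A, -, -, -, -, ⟨φ, hφ⟩, herr⟩ := h.exists_leastSquares hI htr hm hmn rfl
    (β := 1) (κ := 0) le_rfl le_rfl (by simp) (by simp)
  refine iInf₂_le_of_le x (fun i => (φ i : D → ℂ)) (iInf_le_of_le (fun i => hI.memLp _) ?_)
  refine iSup₂_le ?_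
  rintro _ ⟨f, hf, rfl⟩
  have hcoe : ((f : D → ℂ) - ∑ i, f (x i) • (φ i : D → ℂ)) = ((f - A f : H) : D → ℂ) := by
    rw [RKHS.coe_sub, hφ, ← RKHS.coeCLM_apply (∑ i, _), map_sum]
    simp
  rw [hcoe, ← eLpNorm_congr_ae (hI.coe_ae_eq _), ← Lp.enorm_def, ← ofReal_norm]
  refine ENNReal.ofReal_le_ofReal ((herr f).trans ?_)
  rw [one_mul]
  have hm0 : (0 : ℝ) < m := by exact_mod_cast hm
  have hmn' : (m : ℝ) ≤ n + 1 := by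
    have : (m : ℝ) ≤ n := by exact_mod_cast hmn
    linarith
  have hr1 : 1 ≤ ((n : ℝ) + 1) / m := by rw [le_div_iff₀ hm0]; linarith
  have hinf : ⨅ g : singularSpace σ e m, ‖f - (g : H)‖ ≤ 1 := by
    refine (ciInf_le ⟨0, ?_⟩ 0).trans (by simpa using hf)
    rintro _ ⟨g, rfl⟩
    exact norm_nonneg _
  have hinf0 : 0 ≤ ⨅ g : singularSpace σ e m, ‖f - (g : H)‖ :=
    Real.iInf_nonneg fun g => norm_nonneg _
  have hS0 : 0 ≤ ∑' k, σ (m + k) ^ 2 := tsum_nonneg fun k => by positivity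
  have hσm := h.nonneg m
  have hc0 : 0 ≤ c :=
    (div_nonneg (Real.sqrt_nonneg _) (sub_nonneg.2 (Real.one_le_sqrt.2 hr1))).trans hc
  have hmm : (m : ℝ) ≤ ((n : ℝ) + 1) / m * m := le_mul_of_one_le_left hm0.le hr1
  calc _ ≤ c * (σ m + √(1 / m * ∑' k, σ (m + k) ^ 2)) * 1 := by gcongr
    _ = _ := mul_one _

end IsSingularSystem

end ErrorBound

/-! ### Existence of a singular system. -/

section Existence

/-- A family of reals with finite superlevel sets can be enumerated in decreasing order. -/
theorem exists_decreasing_enumeration {J : Type*} [Countable J] (lam : J → ℝ)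
    (hfin : ∀ i, {j | lam i ≤ lam j}.Finite) :
    ∃ ρ : J → ℕ, Function.Injective ρ ∧ (∀ i k, k ≤ ρ i → ∃ j, ρ j = k) ∧
      ∀ i j, lam i < lam j → ρ j < ρ i := by
  obtain ⟨enc, henc⟩ := exists_injective_nat J
  -- The predecessors of i in the decreasing order, ties broken by `enc`; the rank of i is their
  -- number.
  let P : J → Set J := fun i => {j | lam i < lam j ∨ (lam i = lam j ∧ enc j < enc i)}
  have hP : ∀ i, (P i).Finite := fun i => (hfin i).subset fun j hj =>
    hj.elim (fun h => h.le) fun h => h.1.le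
  have hmono : ∀ i j, j ∈ P i → (P j).ncard < (P i).ncard := fun i j hj => by
    refine Set.ncard_lt_ncard ⟨fun k hk => ?_, fun hsub => ?_⟩ (hP i)
    · rcases hj with hj | ⟨hj, hj'⟩ <;> rcases hk with hk | ⟨hk, hk'⟩
      · exact Or.inl (hj.trans hk)
      · exact Or.inl (hk ▸ hj)
      · exact Or.inl (hj ▸ hk)
      · exact Or.inr ⟨hj.trans hk, hk'.trans hj'⟩
    · rcases hsub hj with h | ⟨-, h⟩ <;> exact lt_irrefl _ h
  have htri : ∀ i j, i ≠ j → j ∈ P i ∨ i ∈ P j := fun i j hij => by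
    rcases lt_trichotomy (lam i) (lam j) with h | h | h
    · exact Or.inl (Or.inl h)
    · rcases (henc.ne hij).lt_or_gt with h' | h'
      · exact Or.inr (Or.inr ⟨h.symm, h'⟩)
      · exact Or.inl (Or.inr ⟨h, h'⟩)
    · exact Or.inr (Or.inl h)
  have hinj : Function.Injective fun i => (P i).ncard := fun i j hij => by
    by_contra hne
    rcases htri i j hne with h | h
    · exact (hmono i j h).ne hij.symm
    · exact (hmono j i h).ne hij
  refine ⟨fun i => (P i).ncard, hinj, fun i k hk => ?_, fun i j hij => hmono i j (Or.inl hij)⟩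
  rcases hk.eq_or_lt with rfl | hk
  · exact ⟨i, rfl⟩
  -- The predecessors of i have distinct ranks below that of i, and they are as many as these ranks,
  -- so no rank is skipped.
  have himg : ((hP i).toFinset.image fun j => (P j).ncard) = Finset.range (P i).ncard := by
    refine Finset.eq_of_subset_of_card_le (fun l hl => ?_) ?_
    · obtain ⟨j, hj, rfl⟩ := Finset.mem_image.1 hl
      exact Finset.mem_range.2 (hmono i j ((hP i).mem_toFinset.1 hj))
    · rw [Finset.card_image_of_injective _ hinj, Finset.card_range,
        Set.ncard_eq_toFinset_card _ (hP i)]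
  have : k ∈ (hP i).toFinset.image fun j => (P j).ncard := by
    rw [himg]; exact Finset.mem_range.2 hk
  obtain ⟨j, -, hj⟩ := Finset.mem_image.1 this
  exact ⟨j, hj⟩

universe u

variable {H : Type u} [NormedAddCommGroup H] [InnerProductSpace ℂ H]
  {Y : Type*} [NormedAddCommGroup Y] [InnerProductSpace ℂ Y] [CompleteSpace Y]

/-- Hilbert–Schmidt operators are compact. -/
theorem isCompactOperator_of_summable_norm_sq {ι : Type*} (b : HilbertBasis ι ℂ H) (I : H →L[ℂ] Y)
    (hs : Summable fun i => ‖I (b i)‖ ^ 2) : IsCompactOperator I := by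
  obtain ⟨T, hT⟩ : ∃ T : ι → H →L[ℂ] Y, ∀ i z, T i z = ⟪b i, z⟫_ℂ • I (b i) :=
    ⟨fun i => InnerProductSpace.rankOne ℂ (I (b i)) (b i),
      fun i z => InnerProductSpace.rankOne_apply _ _ _⟩
  -- Cauchy–Schwarz and Bessel bound the operator norm by the Hilbert–Schmidt norm. Hence the finite
  -- rank sums converge in norm.
  have hbound : ∀ t : Finset ι, ‖∑ i ∈ t, T i‖ ≤ √(∑ i ∈ t, ‖I (b i)‖ ^ 2) := fun t => by
    refine ContinuousLinearMap.opNorm_le_bound _ (Real.sqrt_nonneg _) fun z => ?_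
    rw [sum_apply]
    calc ‖∑ i ∈ t, T i z‖ ≤ ∑ i ∈ t, ‖I (b i)‖ * ‖⟪b i, z⟫_ℂ‖ :=
          norm_sum_le_of_le _ fun i _ => by rw [hT, norm_smul, mul_comm]
      _ ≤ √(∑ i ∈ t, ‖I (b i)‖ ^ 2) * √(∑ i ∈ t, ‖⟪b i, z⟫_ℂ‖ ^ 2) :=
          Real.sum_mul_le_sqrt_mul_sqrt _ _ _
      _ ≤ _ := by
          gcongr
          exact Real.sqrt_le_iff.2 ⟨norm_nonneg _, b.orthonormal.sum_inner_products_le z⟩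
  have hsum : Summable T := by
    rw [summable_iff_vanishing_norm]
    intro ε hε
    obtain ⟨s, hs'⟩ := summable_iff_vanishing_norm.1 hs (ε ^ 2) (by positivity)
    refine ⟨s, fun t ht => (hbound t).trans_lt ?_⟩
    rw [Real.sqrt_lt' hε]
    exact (Real.le_norm_self _).trans_lt (hs' t ht)
  obtain ⟨L, hL⟩ := hsum
  have hLI : L = I := by
    ext1 z
    have h1 : HasSum (fun i => T i z) (L z) := (ContinuousLinearMap.apply ℂ Y z).hasSum hL
    have h2 : HasSum (fun i => T i z) (I z) := by
      have := I.hasSum (b.hasSum_repr z)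
      simpa only [map_smul, HilbertBasis.repr_apply_apply, hT] using this
    exact h1.unique h2
  rw [← hLI]
  refine isCompactOperator_of_tendsto hL (Filter.Eventually.of_forall fun s => ?_)
  refine (compactOperator (RingHom.id ℂ) H Y).sum_mem (f := T) (t := s) fun i _ => ?_
  have : (T i : H → Y) =
      (ContinuousLinearMap.toSpanSingleton ℂ (I (b i))) ∘ (innerSL ℂ (b i)) := by
    ext z; rw [hT]; simp
  change IsCompactOperator (T i : H → Y)
  rw [this]
  exact ((isCompactOperator_id (E := ℂ)).comp_clm (innerSL ℂ (b i))).clm_comp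
    (ContinuousLinearMap.toSpanSingleton ℂ (I (b i)))

variable [CompleteSpace H]

/-- The spectral theorem: a Hilbert basis of eigenvectors of `I* I`. -/
theorem exists_hilbertBasis_eigenvectors {I : H →L[ℂ] Y} (hI : IsCompactOperator I) :
    ∃ (J : Type u) (b : HilbertBasis J ℂ H), ∀ j,
      ContinuousLinearMap.adjoint I (I (b j)) = ((‖I (b j)‖ : ℂ) ^ 2) • b j := by
  obtain ⟨T, hT, hTc⟩ : ∃ T : H →L[ℂ] H, (∀ z, T z = ContinuousLinearMap.adjoint I (I z)) ∧
      IsCompactOperator T :=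
    ⟨ContinuousLinearMap.adjoint I ∘L I, fun _ => rfl, hI.clm_comp (ContinuousLinearMap.adjoint I)⟩
  have hTs : (T : H →ₗ[ℂ] H).IsSymmetric := fun x y => by
    rw [ContinuousLinearMap.coe_coe, hT, hT, ContinuousLinearMap.adjoint_inner_left, ContinuousLinearMap.adjoint_inner_right]
  have hbot := ContinuousLinearMap.orthogonalComplement_iSup_eigenspaces_eq_bot hTc hTs
  let G : ℂ → Submodule ℂ H := fun ν => Module.End.eigenspace (T : H →ₗ[ℂ] H) ν
  have hGmem : ∀ ν z, z ∈ G ν ↔ T z = ν • z := fun ν z => Module.End.mem_eigenspace_iff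
  have hGclosed : ∀ ν, IsClosed (G ν : Set H) := fun ν => by
    have : (G ν : Set H) = {z | T z = ν • z} := by ext z; exact hGmem ν z
    rw [this]
    exact isClosed_eq T.continuous (continuous_const_smul ν)
  have hGc : ∀ ν, CompleteSpace (G ν) := fun ν => (hGclosed ν).completeSpace_coe
  -- Hilbert bases of the mutually orthogonal eigenspaces are glued together; totality follows from
  -- the spectral theorem.
  choose w b hb using fun ν => exists_hilbertBasis ℂ (G ν)
  have horth : Orthonormal ℂ fun a : Σ ν, w ν => ((b a.1 a.2 : G a.1) : H) :=
    hTs.orthogonalFamily_eigenspaces.orthonormal_sigma_orthonormal fun ν => (b ν).orthonormal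
  have hspan : (Submodule.span ℂ (Set.range fun a : Σ ν, w ν => ((b a.1 a.2 : G a.1) : H)))ᗮ = ⊥ := by
    rw [eq_bot_iff, ← hbot]
    intro z hz
    rw [Submodule.mem_orthogonal]
    intro y hy
    have hle : ∀ ν, G ν ≤ (Submodule.span ℂ {z})ᗮ := fun ν y hy => by
      rw [Submodule.mem_orthogonal_singleton_iff_inner_right]
      have h1 := (b ν).hasSum_repr ⟨y, hy⟩
      have h2 := ((innerSL ℂ z) ∘L (G ν).subtypeL).hasSum h1
      have h3 : ∀ i, ((innerSL ℂ z) ∘L (G ν).subtypeL) ((b ν).repr ⟨y, hy⟩ i • b ν i) = 0 := by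
        intro i
        rw [map_smul]
        have : ⟪z, ((b ν i : G ν) : H)⟫_ℂ = 0 :=
          (Submodule.mem_orthogonal' _ _).1 hz _ (Submodule.subset_span ⟨⟨ν, i⟩, rfl⟩)
        simp [this]
      simp only [h3] at h2
      exact h2.unique hasSum_zero
    have := (iSup_le hle : (⨆ ν, G ν) ≤ _) hy
    rw [Submodule.mem_orthogonal_singleton_iff_inner_left] at this
    exact this
  refine ⟨_, HilbertBasis.mkOfOrthogonalEqBot horth hspan, fun a => ?_⟩
  simp only [HilbertBasis.coe_mkOfOrthogonalEqBot]
  set u : H := ((b a.1 a.2 : G a.1) : H) with hu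
  have hu1 : ‖u‖ = 1 := horth.1 a
  have hTu : T u = a.1 • u := (hGmem _ _).1 (b a.1 a.2).2
  have h1 : ⟪u, T u⟫_ℂ = (‖I u‖ : ℂ) ^ 2 := by
    rw [hT, ContinuousLinearMap.adjoint_inner_right, inner_self_eq_norm_sq_to_K]
    rfl
  rw [hTu, inner_smul_right, inner_self_eq_norm_sq_to_K, hu1] at h1
  rw [← hT, hTu, ← h1]
  simp

/-- Injectivity makes every singular value positive. Summability then makes the eigenbasis countable
and the superlevel sets finite, so it can be enumerated decreasingly and extended by zero. -/
theorem exists_isSingularSystem {I : H →L[ℂ] Y} (hI : Function.Injective I)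
    (hs : ∀ {ι : Type u} {v : ι → H}, Orthonormal ℂ v → Summable fun i => ‖I (v i)‖ ^ 2) :
    ∃ (σ : ℕ → ℝ) (e : ℕ → H), IsSingularSystem I σ e := by
  obtain ⟨w, b₀, hb₀⟩ := exists_hilbertBasis ℂ H
  obtain ⟨J, b, hb⟩ := exists_hilbertBasis_eigenvectors
    (isCompactOperator_of_summable_norm_sq b₀ I (hs b₀.orthonormal))
  have hsum := hs b.orthonormal
  have hpos : ∀ j, 0 < ‖I (b j)‖ := fun j => norm_pos_iff.2 fun h0 =>
    b.orthonormal.ne_zero j (hI (by rw [h0, map_zero]))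
  have hcount : Countable J := by
    have := hsum.countable_support
    rw [Function.support_eq_univ fun j => (pow_pos (hpos j) 2).ne'] at this
    exact Set.countable_univ_iff.1 this
  obtain ⟨ρ, hρ, hinit, hlt⟩ := exists_decreasing_enumeration (fun j => ‖I (b j)‖) fun i => by
    have h1 := hsum.tendsto_cofinite_zero.eventually (gt_mem_nhds (pow_pos (hpos i) 2))
    rw [Filter.eventually_cofinite] at h1
    refine h1.subset fun j hj => not_lt.2 ?_
    exact pow_le_pow_left₀ (norm_nonneg _) hj 2
  set σ : ℕ → ℝ := Function.extend ρ (fun j => ‖I (b j)‖) 0 with hσ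
  set e : ℕ → H := Function.extend ρ b 0 with he
  have hσρ : ∀ j, σ (ρ j) = ‖I (b j)‖ := fun j => hρ.extend_apply _ _ _
  have heρ : ∀ j, e (ρ j) = b j := fun j => hρ.extend_apply _ _ _
  have hσ0 : ∀ k, (¬∃ j, ρ j = k) → σ k = 0 := fun k hk => Function.extend_apply' _ _ _ hk
  have he0 : ∀ k, (¬∃ j, ρ j = k) → e k = 0 := fun k hk => Function.extend_apply' _ _ _ hk
  have hnonneg : ∀ k, 0 ≤ σ k := fun k => by
    by_cases hk : ∃ j, ρ j = k
    · obtain ⟨j, rfl⟩ := hk; rw [hσρ]; exact norm_nonneg _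
    · rw [hσ0 k hk]
  refine ⟨σ, e, ⟨fun k l hkl => ?_, hnonneg, ?_, ?_, fun k hk => ?_, fun k => ?_⟩⟩
  · by_cases hl : ∃ i, ρ i = l
    · obtain ⟨i, rfl⟩ := hl
      obtain ⟨j, rfl⟩ := hinit i k hkl
      rw [hσρ, hσρ]
      exact not_lt.1 fun h => absurd (hlt _ _ h) (not_lt.2 hkl)
    · rw [hσ0 l hl]; exact hnonneg k
  · have hex : ∀ k : {k : ℕ // 0 < σ k}, ∃ j, ρ j = k := fun k => by
      by_contra h0
      exact k.2.ne' (hσ0 k h0)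
    choose g hg using hex
    have hfun : (fun k : {k : ℕ // 0 < σ k} => e k) = b ∘ g := by
      ext1 k
      rw [← hg k, heρ]; rfl
    rw [hfun]
    refine b.orthonormal.comp g fun k l hkl => Subtype.ext ?_
    rw [← hg k, ← hg l, hkl]
  · rw [eq_top_iff, ← b.dense_span]
    refine Submodule.topologicalClosure_mono (Submodule.span_mono ?_)
    rintro _ ⟨j, rfl⟩
    exact ⟨ρ j, heρ j⟩
  · refine he0 k ?_
    rintro ⟨j, rfl⟩
    exact (hpos j).ne' ((hσρ j).symm.trans hk)
  · by_cases hk : ∃ j, ρ j = k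
    · obtain ⟨j, rfl⟩ := hk
      rw [hσρ, heρ, hb]
    · rw [he0 k hk]; simp

end Existence

/-! ### Assembly of the main theorem. -/

theorem IsL2Embedding.summable_norm_sq {D : Type*} [MeasurableSpace D] {μ : Measure D}
    {H : Type*} [NormedAddCommGroup H] [InnerProductSpace ℂ H] [CompleteSpace H] [RKHS ℂ H D ℂ]
    {I : H →L[ℂ] Lp ℂ 2 μ} (hI : IsL2Embedding μ I) (htr : HasFiniteTrace μ H) {ι : Type*}
    {v : ι → H} (hv : Orthonormal ℂ v) : Summable fun i => ‖I (v i)‖ ^ 2 := by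
  refine (ENNReal.summable_toReal ((hI.tsum_enorm_sq_le hv).trans_lt htr).ne).congr fun i => ?_
  rw [ENNReal.toReal_pow, toReal_enorm]

theorem theorem3p24 {D : Type*} [Nonempty D] [MeasurableSpace D] (μ : Measure D)
    {H : Type*} [NormedAddCommGroup H] [InnerProductSpace ℂ H] [CompleteSpace H]
    [RKHS ℂ H D ℂ] (I : H →L[ℂ] Lp ℂ 2 μ) (hI : IsL2Embedding μ I)
    (htr : HasFiniteTrace μ H) :
    -- the embedding has a singular system
    (∃ (σ : ℕ → ℝ) (e : ℕ → H), IsSingularSystem I σ e) ∧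
    ∀ (σ : ℕ → ℝ) (e : ℕ → H), IsSingularSystem I σ e →
      Summable (fun k => σ k ^ 2) ∧
      -- the error bounds for weighted least squares
      (∀ (m n : ℕ) (r : ℝ), 1 ≤ m → m ≤ n → r = ((n : ℝ) + 1) / m →
        (∃ (x : Fin n → D) (w : Fin n → ℝ) (A : (D → ℂ) → H),
          (∀ i, 0 < w i) ∧
          IsLeastSquaresAlgorithm (singularSpace σ e m) x w A ∧
          ∀ f : H, ‖I (f - A f)‖ ≤
            √(2 * r) / (√r - 1) * (σ m + √(1 / (r * m) * ∑' k, σ (m + k) ^ 2)) *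
              ⨅ g : singularSpace σ e m, ‖f - (g : H)‖) ∧
        (IsProbabilityMeasure μ → (∃ g ∈ singularSpace σ e m, ∀ t : D, g t = 1) →
          ∃ (x : Fin n → D) (w : Fin n → ℝ) (A : (D → ℂ) → H),
            (∀ i, 0 < w i) ∧
            ∑ i, w i ≤ 9 ∧
            (∀ g ∈ singularSpace σ e m,
              ‖I g‖ ≤ √r / (√r - 1) * √(discreteNormSq x w g)) ∧
            IsLeastSquaresAlgorithm (singularSpace σ e m) x w A ∧
            ∀ f : H, ‖I (f - A f)‖ ≤
              4 * (√(2 * r) / (√r - 1) * (σ m + √(1 / (r * m) * ∑' k, σ (m + k) ^ 2)) *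
                ⨅ g : singularSpace σ e m, ‖f - (g : H)‖))) ∧
      -- the bounds for the linear sampling numbers of the unit ball
      (∀ m : ℕ, 1 ≤ m →
        linSamplingNumber (2 * m - 1) (unitBall D H) μ ≤
          ENNReal.ofReal (5 * (σ m + √(1 / m * ∑' k, σ (m + k) ^ 2))) ∧
        linSamplingNumber m (unitBall D H) μ ≤
          ENNReal.ofReal (5 * m * (σ m + √(1 / m * ∑' k, σ (m + k) ^ 2)))) := by
  refine ⟨exists_isSingularSystem hI.injective fun hv => hI.summable_norm_sq htr hv,
    fun σ e h => ⟨h.summable_sq hI htr, fun m n r hm hmn hr => ⟨?_, fun hμ _ => ?_⟩,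
      fun m hm => ⟨?_, ?_⟩⟩⟩
  · obtain ⟨x, w, A, hw, -, -, hA, -, herr⟩ := h.exists_leastSquares hI htr hm hmn hr
      (β := 1) (κ := 0) le_rfl le_rfl (by simp) (by simp)
    exact ⟨x, w, A, hw, hA, fun f => by simpa only [one_mul] using herr f⟩
  -- The budget 1/16 + 1/9 ≤ 1 permits both the factor 4 and the cap w_i ≤ 9/(n+1).
  · obtain ⟨x, w, A, hw, hκ, hlow, hA, -, herr⟩ := h.exists_leastSquares hI htr hm hmn hr
      (β := 4) (κ := 1 / 9) (by norm_num) (by norm_num) (integrable_const _)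
      (by rw [integral_const]; norm_num)
    refine ⟨x, w, A, hw, ?_, hlow, hA, herr⟩
    have hn : (0 : ℝ) < n + 1 := by positivity
    calc ∑ i, w i ≤ ∑ _i : Fin n, 9 / ((n : ℝ) + 1) := Finset.sum_le_sum fun i _ => by
          rw [le_div_iff₀ hn]; linarith [hκ i]
      _ = n * 9 / ((n : ℝ) + 1) := by
          rw [Finset.sum_const, Finset.card_univ, Fintype.card_fin, nsmul_eq_mul, mul_div_assoc]
      _ ≤ 9 := by rw [div_le_iff₀ hn]; linarith
  · refine h.linSamplingNumber_le hI htr hm (by omega) ?_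
    have hm0 : (0 : ℝ) < m := by exact_mod_cast hm
    have hr : (((2 * m - 1 : ℕ) : ℝ) + 1) / m = 2 := by
      rw [Nat.cast_sub (by omega)]
      push_cast
      field_simp
      ring
    have h4 : √((2 : ℝ) * 2) = 2 := Real.sqrt_mul_self zero_le_two
    -- For r = 2 the claim is 2 ≤ 5 (√2 - 1), and 7/5 gives equality.
    have h2 : 7 / 5 ≤ √(2 : ℝ) := Real.le_sqrt_of_sq_le (by norm_num)
    rw [hr, h4, div_le_iff₀ (by linarith)]
    linarith
  · refine h.linSamplingNumber_le hI htr hm le_rfl ?_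
    have hm0 : (1 : ℝ) ≤ m := by exact_mod_cast hm
    set r := ((m : ℝ) + 1) / m with hr
    have hmr : m * (r - 1) = 1 := by rw [hr]; field_simp; ring
    have hr1 : 1 < r := by rw [hr, lt_div_iff₀ (by linarith)]; linarith
    have hr2 : r ≤ 2 := by rw [hr, div_le_iff₀ (by linarith)]; linarith
    have hsr : 1 < √r := Real.lt_sqrt_of_sq_lt (by linarith)
    have hsq : √r ^ 2 = r := Real.sq_sqrt (by linarith)
    have h2 : √(2 : ℝ) ≤ 3 / 2 := Real.sqrt_le_iff.2 ⟨by norm_num, by norm_num⟩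
    have hs2 : √r ≤ √2 := Real.sqrt_le_sqrt hr2
    have h22 : √(2 : ℝ) ^ 2 = 2 := Real.sq_sqrt zero_le_two
    rw [Real.sqrt_mul zero_le_two, div_le_iff₀ (by linarith)]
    -- Multiplying by √r + 1 rationalizes the denominator, since (√r - 1)(√r + 1) = r - 1 = 1/m.
    have key : √2 * √r * (√r + 1) ≤ 5 := by
      calc √2 * √r * (√r + 1) ≤ √2 * √2 * (√2 + 1) := by gcongr
        _ ≤ 5 := by nlinarith
    have hmul : (m : ℝ) * (√r - 1) * (√r + 1) = 1 := by
      have : (m : ℝ) * (√r - 1) * (√r + 1) = m * (√r ^ 2 - 1) := by ring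
      rw [this, hsq, hmr]
    refine le_of_mul_le_mul_right ?_ (by linarith : 0 < √r + 1)
    calc √2 * √r * (√r + 1) ≤ 5 := key
      _ = 5 * m * (√r - 1) * (√r + 1) := by linear_combination -5 * hmul
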